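/- Let $\Bbbk$ be an algebraically closed field of characteristic zero, let $b\ge 2$ be an integer, and let $\mathbb X\subset\mathbb P^2_{\Bbbk}$ be the standard $\Bbbk$-configuration of type $(1,b,2b)$, that is, the set of the points $$R=[1:0:2],\qquad Q_i=[1:i-1:1]\ (1\le i\le b),\qquad P_i=[1:i-1:0]\ (1\le i\le 2b).$$ Let $I_{\mathbb X}\subset\Bbbk[x_0,x_1,x_2]$ be its homogeneous ideal, $I_{\mathbb X}^{(t)}=\bigcap_{\mathfrak p\in\mathrm{Ass}(I_{\mathbb X})}(I_{\mathbb X}^tS_{\mathfrak p}\cap S)$ (with $S=\Bbbk[x_0,x_1,x_2]$) the $t$-th symbolic power, and $\alpha(J)$ the least degree of a nonzero form in a nonzero homogeneous ideal $J$. (a) The Waldschmidt constant of $I_{\mathbb X}$ is $$\widehat\alpha(I_{\mathbb X})=\lim_{t\to\infty}\frac{\alpha(I_{\mathbb X}^{(t)})}{t}=\frac{6b-5}{2b-1}.$$ (b) For every integer $m\ge 1$, $\alpha\big(I_{\mathbb X}^{(m(2b-1))}\big)=m(6b-5)$. (c) There is exactly one curve $\mathcal C$ of degree $b$ that passes through $P_2,P_4,\dots,P_{2b},Q_1,\dots,Q_b$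 and has multiplicity at least $b-1$ at $R$, and it is irreducible. Let $\mathcal L_1=\{x_2=0\}$ and $\mathcal L_2=\{x_2=x_0\}$ be the lines that contain the $P_i$ and the $Q_i$ respectively, and, for $1\le i\le b$, let $\mathcal M_i=\{x_1+(i-1)(x_2-2x_0)=0\}$ be the line through $P_{2i-1}$, $Q_i$ and $R$. Then the curve $$\mathcal F=(2b-2)\mathcal L_1+(2b-3)\mathcal L_2+\mathcal M_1+\cdots+\mathcal M_b+\mathcal C$$ has degree $6b-5$ and multiplicity exactly $2b-1$ at each point of $\mathbb X$. (d) For every $m\ge1$ and every $d\le m(6b-5)$, $\mathcal C$ is a fixed component of the linear system of curves of degree $d$ that have multiplicity at least $m(2b-1)$ at each point of $\mathbb X$: every form of degree $d$ in $\bigcap_{P\in\mathbb X}I_P^{m(2b-1)}$, where $I_P$ is the homogeneous ideal of the point $P$, is divisible by an equation of $\mathcal C$. -/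

import Mathlib

open MvPolynomial Filter Topology
open scoped LinearAlgebra.Projectivization

/-- The projective plane over `k`, as the set of lines through the origin of `k³`. -/
abbrev ProjPlane (k : Type*) [Field k] : Type _ := ℙ k (Fin 3 → k)

/-- The point `[1 : u : v]`. -/
def affinePoint {k : Type*} [Field k] (u v : k) : ProjPlane k :=
  Projectivization.mk k ![1, u, v] (fun h => one_ne_zero (congrFun h 0))

/-- `X` is the standard `k`-configuration of type `(d 0, …, d (s - 1))`: the type is a strictly
increasing sequence of positive integers, and `X` consists of the points `[1 : j : s - 1 - i]`
with `i < s` and `j < d i`. -/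
structure IsStandardKConfiguration {k : Type*} [Field k] {s : ℕ} (d : Fin s → ℕ)
    (X : Set (ProjPlane k)) : Prop where
  pos : ∀ i, 1 ≤ d i
  strictMono : StrictMono d
  eq_points : X = {P | ∃ i : Fin s, ∃ j : ℕ, j < d i ∧
    P = affinePoint (j : k) ((s - 1 - (i : ℕ) : ℕ) : k)}

/-- The homogeneous ideal of a set of points: it is generated by the forms that vanish on the
set. For a form the choice of the representative of a point does not matter. -/
noncomputable def pointsIdeal {k : Type*} [Field k] (X : Set (ProjPlane k)) :
    Ideal (MvPolynomial (Fin 3) k) :=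
  Ideal.span {f | (∃ n : ℕ, f.IsHomogeneous n) ∧ ∀ P ∈ X, eval P.rep f = 0}

/-- The ideal of the fat point `m P`, i.e. of the curves with multiplicity at least `m` at `P`. -/
noncomputable def fatPointIdeal {k : Type*} [Field k] (P : ProjPlane k) (m : ℕ) :
    Ideal (MvPolynomial (Fin 3) k) :=
  pointsIdeal {P} ^ m

/-- The ideal of the scheme `m X` of fat points. -/
noncomputable def fatPointsIdeal {k : Type*} [Field k] (X : Set (ProjPlane k)) (m : ℕ) :
    Ideal (MvPolynomial (Fin 3) k) :=
  ⨅ P ∈ X, fatPointIdeal P m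

/-- The curve `f = 0` has multiplicity exactly `m` at `P`. -/
def HasMultiplicityAt {k : Type*} [Field k] (f : MvPolynomial (Fin 3) k) (P : ProjPlane k)
    (m : ℕ) : Prop :=
  f ∈ fatPointIdeal P m ∧ f ∉ fatPointIdeal P (m + 1)

/-- The symbolic power `I^(t)`: the intersection, over the associated primes `P` of `R ⧸ I`, of
the contractions `I ^ t R_P ∩ R`. -/
noncomputable def symbolicPower {R : Type*} [CommRing R] (I : Ideal R) (t : ℕ) : Ideal R :=
  ⨅ P : associatedPrimes R (R ⧸ I),
    ((I ^ t).map (algebraMap R (Localization.AtPrime P.1))).comap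
      (algebraMap R (Localization.AtPrime P.1))

/-- The initial degree of a nonzero homogeneous ideal: the least degree of a nonzero form in it. -/
noncomputable def initialDegree {k σ : Type*} [Field k] (I : Ideal (MvPolynomial σ k)) : ℕ :=
  sInf {d : ℕ | ∃ f ∈ I, f ≠ 0 ∧ f.IsHomogeneous d}

/-- `c` is the Waldschmidt constant of `I`: the limit of `α(I^(t)) / t` as `t → ∞` exists and
equals `c`. -/
def IsWaldschmidtConstant {k σ : Type*} [Field k] (I : Ideal (MvPolynomial σ k)) (c : ℝ) : Prop :=
  Tendsto (fun t : ℕ => (initialDegree (symbolicPower I t) : ℝ) / (t : ℝ)) atTop (𝓝 c)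

/-- The form `f` defines a curve of degree `b` through the `2 b` points `[1 : 2 i + 1 : 0]` and
`[1 : i : 1]` for `0 ≤ i < b`, with multiplicity at least `b - 1` at `[1 : 0 : 2]` (or `f = 0`). -/
def PassesThroughHalf {k : Type*} [Field k] (b : ℕ) (f : MvPolynomial (Fin 3) k) : Prop :=
  f.IsHomogeneous b ∧
  (∀ i : ℕ, i < b → f ∈ pointsIdeal {affinePoint (2 * (i : k) + 1) 0}) ∧
  (∀ i : ℕ, i < b → f ∈ pointsIdeal {affinePoint (i : k) 1}) ∧
  f ∈ fatPointIdeal (affinePoint (0 : k) 2) (b - 1)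

/-- The form `L₁ ^ (2 b - 2) * L₂ ^ (2 b - 3) * M₁ * ⋯ * M_b * f` for `b ≥ 2`, where `L₁ = x₂`,
`L₂ = x₂ - x₀`, and `M_{i+1} = x₁ + i (x₂ - 2 x₀)` is the line that joins `[1 : i : 1]` to
`[1 : 0 : 2]`; it also contains `[1 : 2 i : 0]`. -/
noncomputable def extremalForm {k : Type*} [Field k] (b : ℕ) (f : MvPolynomial (Fin 3) k) :
    MvPolynomial (Fin 3) k :=
  X 2 ^ (2 * b - 2) * (X 2 - X 0) ^ (2 * b - 3) *
    (∏ i ∈ Finset.range b, (X 1 + C (i : k) * (X 2 - 2 * X 0))) * f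

/-!
The proof is Bézout's theorem for a handful of rational curves.

The curve `C` is written down explicitly (`rationalCurve`). In the coordinates `y = x₁`,
`z = x₂ - 2 x₀` at `R = [1 : 0 : 2]` and `w = x₂`, a curve of degree `b` with multiplicity `b - 1`
at `R` is `w A(y, z) + B(y, z)`. The points on `w = 0` determine `B` up to a scalar, and those on
`w = -z` determine `B - z A`. Both are products of linear forms, without a common factor, so the
equation is irreducible, and `[y : z : w] = [y A : z A : -B]` parametrizes the curve. Restriction to
this parametrization, and to the parametrizations of the lines `L₁`, `L₂` and `Mᵢ`, turns Bézout's
inequality into a count of zeros of a polynomial in one variable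
(`sum_add_sum_add_le_of_not_rationalCurve_dvd`, `sum_le_of_not_lineForm_dvd`).

Bézout's inequality for `C` alone shows that `C` is unique, and that it is a component of every
curve of degree at most `m (6 b - 5)` with multiplicities at least `m (2 b - 1)`. For the lower bound
`(2 b - 1) d ≥ (6 b - 5) T` for curves of degree `d` with multiplicities at least `T`
(`le_degree_of_hasMultiplicitiesGE`), all copies of `L₁`, `L₂`, `Mᵢ` and `C` are split off. The
residual curve satisfies Bézout's inequality with each of them, and a positive linear combination of
these inequalities, in which the multiplicities of the removed components cancel, is the bound.
The extremal form attains it. Since the symbolic powers decrease, the powers of the extremal form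
bound the initial degree of every symbolic power from above, within a constant of the lower bound,
and the Waldschmidt constant follows.

Multiplicities are computed through a contraction of the plane towards a point with ratio `s`
(`contraction`): the multiplicity is the order in `s` of the image of a form
(`mem_fatPointIdeal_iff`). This makes multiplicities additive, hence the powers of the ideal of a
point primary, and identifies the symbolic powers with the ideals of fat points
(`symbolicPower_pointsIdeal`).
-/

/-! ### Multiplicities of plane curves at a point -/

section Multiplicity

variable {k : Type*} [Field k]

theorem aeval_mul_of_isHomogeneous {σ S : Type*} [CommRing S] [Algebra k S] {n : ℕ}
    {g : MvPolynomial σ k} (hg : g.IsHomogeneous n) (a : S) (x : σ → S) :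
    aeval (fun i => a * x i) g = a ^ n * aeval x g := by
  rw [aeval_def, aeval_def, eval₂_eq, eval₂_eq, Finset.mul_sum]
  refine Finset.sum_congr rfl fun d hd => ?_
  have hdeg : ∑ i ∈ d.support, d i = n := (hg.degree_eq_sum_deg_support hd).symm
  simp only [mul_pow, Finset.prod_mul_distrib, Finset.prod_pow_eq_pow_sum, hdeg]
  ring

/-- The substitution that contracts the plane towards the point `[1 : u : v]` with ratio `s`, where
`s` is a new variable: it fixes `x₀` and multiplies the local coordinates `x₁ - u x₀` and
`x₂ - v x₀` by `s`. The order of vanishing in `s` of the image of a polynomial is the multiplicity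
at `[1 : u : v]`. -/
noncomputable def contraction (u v : k) :
    MvPolynomial (Fin 3) k →ₐ[k] Polynomial (MvPolynomial (Fin 3) k) :=
  aeval ![Polynomial.C (X 0),
    Polynomial.C (C u * X 0) + Polynomial.X * Polynomial.C (X 1 - C u * X 0),
    Polynomial.C (C v * X 0) + Polynomial.X * Polynomial.C (X 2 - C v * X 0)]

@[simp]
theorem contraction_X_zero (u v : k) : contraction u v (X 0) = Polynomial.C (X 0) := by
  simp [contraction]

@[simp]
theorem contraction_X_one (u v : k) : contraction u v (X 1) =
    Polynomial.C (C u * X 0) + Polynomial.X * Polynomial.C (X 1 - C u * X 0) := by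
  simp [contraction]

@[simp]
theorem contraction_X_two (u v : k) : contraction u v (X 2) =
    Polynomial.C (C v * X 0) + Polynomial.X * Polynomial.C (X 2 - C v * X 0) := by
  simp [contraction]

@[simp]
theorem contraction_C (u v a : k) : contraction u v (C a) = Polynomial.C (C a) :=
  (contraction u v).commutes a

/-- The ideal generated by the local coordinates at `[1 : u : v]`. -/
noncomputable def localCoordIdeal (u v : k) : Ideal (MvPolynomial (Fin 3) k) :=
  Ideal.span {X 1 - C u * X 0, X 2 - C v * X 0}

theorem contraction_mem_reesAlgebra (u v : k) (g : MvPolynomial (Fin 3) k) :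
    contraction u v g ∈ reesAlgebra (localCoordIdeal u v) := by
  have hmem : ∀ a ∈ localCoordIdeal u v,
      Polynomial.X * Polynomial.C a ∈ reesAlgebra (localCoordIdeal u v) := by
    intro a ha
    rw [mul_comm, Polynomial.C_mul_X_eq_monomial, reesAlgebra.monomial_mem, pow_one]
    exact ha
  have hC : ∀ a, Polynomial.C a ∈ reesAlgebra (localCoordIdeal u v) :=
    fun a => Subalgebra.algebraMap_mem _ a
  induction g using MvPolynomial.induction_on with
  | C a => rw [contraction_C]; exact hC _
  | add p q hp hq => rw [map_add]; exact Subalgebra.add_mem _ hp hq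
  | mul_X p i hp =>
    rw [map_mul]
    refine Subalgebra.mul_mem _ hp ?_
    fin_cases i
    · simpa using hC (X 0)
    · change contraction u v (X 1) ∈ _
      rw [contraction_X_one]
      exact Subalgebra.add_mem _ (hC _) (hmem _ (Ideal.subset_span (by simp)))
    · change contraction u v (X 2) ∈ _
      rw [contraction_X_two]
      exact Subalgebra.add_mem _ (hC _) (hmem _ (Ideal.subset_span (by simp)))

theorem eval_one_contraction (u v : k) (g : MvPolynomial (Fin 3) k) :
    (contraction u v g).eval 1 = g := by
  induction g using MvPolynomial.induction_on with
  | C a => simp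
  | add p q hp hq => rw [map_add, Polynomial.eval_add, hp, hq]
  | mul_X p i hp =>
    rw [map_mul, Polynomial.eval_mul, hp]
    congr 1
    fin_cases i
    · simp
    · change (contraction u v (X 1)).eval 1 = X 1
      simp
    · change (contraction u v (X 2)).eval 1 = X 2
      simp

/-- A power of the ideal of local coordinates is detected by the contraction: the coefficient of
`s ^ j` in the contraction of `g` lies in the `j`-th power, and `g` is the sum of the
coefficients. -/
theorem mem_localCoordIdeal_pow_iff (u v : k) (n : ℕ) (g : MvPolynomial (Fin 3) k) :
    g ∈ localCoordIdeal u v ^ n ↔ Polynomial.X ^ n ∣ contraction u v g := by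
  constructor
  · intro hg
    have hle : (localCoordIdeal u v).map (contraction u v) ≤ Ideal.span {Polynomial.X} := by
      rw [localCoordIdeal, Ideal.map_span, Ideal.span_le]
      rintro _ ⟨a, (rfl | rfl), rfl⟩
      · simp [Ideal.mem_span_singleton]
      · simp [Ideal.mem_span_singleton]
    have := Ideal.pow_right_mono hle n (by
      rw [← Ideal.map_pow]; exact Ideal.mem_map_of_mem _ hg)
    rwa [Ideal.span_singleton_pow, Ideal.mem_span_singleton] at this
  · intro hg
    rw [← eval_one_contraction u v g, Polynomial.eval_eq_sum]
    refine Ideal.sum_mem _ fun j _ => ?_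
    simp only [one_pow, mul_one]
    rcases lt_or_ge j n with hj | hj
    · rw [Polynomial.X_pow_dvd_iff.mp hg j hj]
      exact Ideal.zero_mem _
    · exact Ideal.pow_le_pow_right hj (contraction_mem_reesAlgebra u v g j)

theorem coeff_zero_contraction {n : ℕ} (u v : k) {g : MvPolynomial (Fin 3) k}
    (hg : g.IsHomogeneous n) :
    (contraction u v g).coeff 0 = C (eval ![1, u, v] g) * X 0 ^ n := by
  have h1 : (Polynomial.constantCoeff.comp (contraction u v).toRingHom) g =
      aeval (fun i => (X 0 : MvPolynomial (Fin 3) k) * C (![1, u, v] i)) g := by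
    change _ = (aeval (fun i => (X 0 : MvPolynomial (Fin 3) k) * C (![1, u, v] i))).toRingHom g
    congr 1
    apply MvPolynomial.ringHom_ext
    · intro a; simp
    · intro i
      fin_cases i
      · simp
      · change (contraction u v (X 1)).coeff 0 = aeval _ (X 1)
        simp [mul_comm]
      · change (contraction u v (X 2)).coeff 0 = aeval _ (X 2)
        simp [mul_comm]
  change (contraction u v g).coeff 0 = _ at h1
  rw [h1, aeval_mul_of_isHomogeneous hg, mul_comm]
  congr 1
  clear h1 hg
  induction g using MvPolynomial.induction_on with
  | C a => simp
  | add p q hp hq => rw [map_add, map_add, map_add, hp, hq]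
  | mul_X p i hp => rw [map_mul, map_mul, map_mul, hp, aeval_X, eval_X]

theorem eval_rep_affinePoint_eq_zero_iff {n : ℕ} (u v : k) {g : MvPolynomial (Fin 3) k}
    (hg : g.IsHomogeneous n) :
    eval (affinePoint u v).rep g = 0 ↔ eval ![1, u, v] g = 0 := by
  obtain ⟨a, ha⟩ := Projectivization.exists_smul_eq_mk_rep k ![1, u, v]
    (fun h => one_ne_zero (congrFun h 0))
  have hrep : (affinePoint u v).rep = (a : k) • ![1, u, v] := ha.symm
  rw [hrep]
  have : eval ((a : k) • ![1, u, v]) g = (a : k) ^ n * eval ![1, u, v] g := by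
    rw [← coe_aeval_eq_eval, ← coe_aeval_eq_eval]
    exact aeval_mul_of_isHomogeneous hg (a : k) ![1, u, v]
  rw [this]
  simp

theorem isHomogeneous_X_sub_C_mul_X (i j : Fin 3) (a : k) :
    (X i - C a * X j : MvPolynomial (Fin 3) k).IsHomogeneous 1 :=
  (isHomogeneous_X _ _).sub (isHomogeneous_C_mul_X _ _)

theorem pointsIdeal_affinePoint (u v : k) :
    pointsIdeal {affinePoint u v} = localCoordIdeal u v := by
  apply le_antisymm
  · rw [pointsIdeal, Ideal.span_le]
    rintro g ⟨⟨n, hn⟩, hg⟩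
    have h0 := (eval_rep_affinePoint_eq_zero_iff u v hn).mp (hg _ rfl)
    rw [SetLike.mem_coe, ← pow_one (localCoordIdeal u v), mem_localCoordIdeal_pow_iff, pow_one,
      Polynomial.X_dvd_iff, coeff_zero_contraction u v hn, h0]
    simp
  · rw [localCoordIdeal, Ideal.span_le]
    rintro g (rfl | rfl) <;> refine Ideal.subset_span ⟨⟨1, isHomogeneous_X_sub_C_mul_X _ _ _⟩, ?_⟩
    all_goals
      rintro P rfl
      rw [eval_rep_affinePoint_eq_zero_iff u v (isHomogeneous_X_sub_C_mul_X _ _ _)]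
      simp

theorem mem_fatPointIdeal_iff (u v : k) (n : ℕ) (g : MvPolynomial (Fin 3) k) :
    g ∈ fatPointIdeal (affinePoint u v) n ↔ Polynomial.X ^ n ∣ contraction u v g := by
  rw [fatPointIdeal, pointsIdeal_affinePoint, mem_localCoordIdeal_pow_iff]

theorem hasMultiplicityAt_iff (u v : k) (n : ℕ) (g : MvPolynomial (Fin 3) k) :
    HasMultiplicityAt g (affinePoint u v) n ↔
      emultiplicity Polynomial.X (contraction u v g) = n := by
  rw [HasMultiplicityAt, mem_fatPointIdeal_iff, mem_fatPointIdeal_iff, emultiplicity_eq_coe]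

theorem HasMultiplicityAt.mul {u v : k} {m n : ℕ} {g h : MvPolynomial (Fin 3) k}
    (hg : HasMultiplicityAt g (affinePoint u v) m) (hh : HasMultiplicityAt h (affinePoint u v) n) :
    HasMultiplicityAt (g * h) (affinePoint u v) (m + n) := by
  rw [hasMultiplicityAt_iff] at *
  rw [map_mul, emultiplicity_mul Polynomial.prime_X, hg, hh, Nat.cast_add]

theorem HasMultiplicityAt.pow {u v : k} {m : ℕ} {g : MvPolynomial (Fin 3) k}
    (hg : HasMultiplicityAt g (affinePoint u v) m) (n : ℕ) :
    HasMultiplicityAt (g ^ n) (affinePoint u v) (n * m) := by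
  rw [hasMultiplicityAt_iff] at *
  rw [map_pow, emultiplicity_pow Polynomial.prime_X, hg, Nat.cast_mul]

theorem HasMultiplicityAt.prod {ι : Type*} {u v : k} (s : Finset ι) {m : ι → ℕ}
    {g : ι → MvPolynomial (Fin 3) k}
    (hg : ∀ i ∈ s, HasMultiplicityAt (g i) (affinePoint u v) (m i)) :
    HasMultiplicityAt (∏ i ∈ s, g i) (affinePoint u v) (∑ i ∈ s, m i) := by
  simp only [hasMultiplicityAt_iff] at *
  rw [map_prod, Finset.emultiplicity_prod Polynomial.prime_X, Finset.sum_congr rfl hg,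
    Nat.cast_sum]

/-- Removing a factor of multiplicity `e` lowers the multiplicity by at most `e`. -/
theorem HasMultiplicityAt.mem_of_mul_mem {u v : k} {e n : ℕ} {g h : MvPolynomial (Fin 3) k}
    (hg : HasMultiplicityAt g (affinePoint u v) e)
    (hgh : g * h ∈ fatPointIdeal (affinePoint u v) n) :
    h ∈ fatPointIdeal (affinePoint u v) (n - e) := by
  rw [hasMultiplicityAt_iff] at hg
  rw [mem_fatPointIdeal_iff, map_mul, pow_dvd_iff_le_emultiplicity,
    emultiplicity_mul Polynomial.prime_X, hg] at hgh
  rw [mem_fatPointIdeal_iff, pow_dvd_iff_le_emultiplicity, ENat.natCast_sub]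
  exact tsub_le_iff_left.mpr hgh

theorem hasMultiplicityAt_zero_iff {n : ℕ} {u v : k} {g : MvPolynomial (Fin 3) k}
    (hg : g.IsHomogeneous n) :
    HasMultiplicityAt g (affinePoint u v) 0 ↔ eval ![1, u, v] g ≠ 0 := by
  rw [HasMultiplicityAt, mem_fatPointIdeal_iff, mem_fatPointIdeal_iff, zero_add, pow_zero,
    pow_one, Polynomial.X_dvd_iff, coeff_zero_contraction u v hg]
  simp

theorem mem_pointsIdeal_affinePoint_iff {n : ℕ} {u v : k} {g : MvPolynomial (Fin 3) k}
    (hg : g.IsHomogeneous n) :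
    g ∈ pointsIdeal {affinePoint u v} ↔ eval ![1, u, v] g = 0 := by
  have := hasMultiplicityAt_zero_iff (u := u) (v := v) hg
  rw [HasMultiplicityAt, fatPointIdeal, fatPointIdeal, pow_zero, zero_add, pow_one] at this
  simpa using not_congr this

/-- A substitution that makes the local coordinates at `[1 : u : v]` divisible by `a` makes every
form of multiplicity `n` at that point divisible by `a ^ n`. -/
theorem pow_dvd_of_mem_fatPointIdeal {S : Type*} [CommRing S] {u v : k} {n : ℕ}
    {g : MvPolynomial (Fin 3) k} (φ : MvPolynomial (Fin 3) k →+* S) {a : S}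
    (h1 : a ∣ φ (X 1 - C u * X 0)) (h2 : a ∣ φ (X 2 - C v * X 0))
    (hg : g ∈ fatPointIdeal (affinePoint u v) n) : a ^ n ∣ φ g := by
  rw [fatPointIdeal, pointsIdeal_affinePoint] at hg
  have hle : (localCoordIdeal u v).map φ ≤ Ideal.span {a} := by
    rw [localCoordIdeal, Ideal.map_span, Ideal.span_le]
    rintro _ ⟨b, (rfl | rfl), rfl⟩
    · simpa only [SetLike.mem_coe, Ideal.mem_span_singleton] using h1
    · simpa only [SetLike.mem_coe, Ideal.mem_span_singleton] using h2
  have := Ideal.pow_right_mono hle n (by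
    rw [← Ideal.map_pow]; exact Ideal.mem_map_of_mem _ hg)
  rwa [Ideal.span_singleton_pow, Ideal.mem_span_singleton] at this

theorem hasMultiplicityAt_of_contraction_eq {u v : k} {n : ℕ} {g : MvPolynomial (Fin 3) k}
    {q : Polynomial (MvPolynomial (Fin 3) k)} (h : contraction u v g = Polynomial.X ^ n * q)
    (hq : q.coeff 0 ≠ 0) : HasMultiplicityAt g (affinePoint u v) n := by
  rw [hasMultiplicityAt_iff, h, emultiplicity_mul Polynomial.prime_X,
    emultiplicity_pow_self_of_prime Polynomial.prime_X, emultiplicity_eq_zero.mpr, add_zero]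
  rwa [Polynomial.X_dvd_iff]

end Multiplicity

/-! ### Forms restricted to rational curves -/

section Restriction

variable {k : Type*} [Field k]

/-- A cofactor of a form in a nonzero form is a form. -/
theorem MvPolynomial.IsHomogeneous.of_mul_left {σ : Type*} {e n : ℕ} {p g : MvPolynomial σ k}
    (hp : p.IsHomogeneous e) (h0 : p * g ≠ 0) (hpg : (p * g).IsHomogeneous n) :
    ∃ j, e + j = n ∧ g.IsHomogeneous j := by
  have hcomp : ∀ j, homogeneousComponent n (p * homogeneousComponent j g) =
      if n = e + j then p * homogeneousComponent j g else 0 := by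
    intro j
    exact homogeneousComponent_of_mem (hp.mul (homogeneousComponent_isHomogeneous j g))
  have hsum : p * g = ∑ j ∈ Finset.range (g.totalDegree + 1),
      if n = e + j then p * homogeneousComponent j g else 0 := by
    simp_rw [← hcomp]
    rw [← map_sum, ← Finset.mul_sum, sum_homogeneousComponent, homogeneousComponent_eq_self hpg]
  obtain ⟨j, -, hj⟩ := Finset.exists_ne_zero_of_sum_ne_zero (hsum ▸ h0)
  have hjn : n = e + j := by
    by_contra h
    exact hj (if_neg h)
  refine ⟨j, hjn.symm, ?_⟩
  have hpj : p * g = p * homogeneousComponent j g := by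
    rw [hsum, Finset.sum_eq_single j, if_pos hjn]
    · intro i _ hi
      exact if_neg fun h => hi (by omega)
    · intro hmem
      rw [if_pos hjn, homogeneousComponent_eq_zero, mul_zero]
      exact not_lt.mp fun hlt => hmem (Finset.mem_range.mpr hlt)
  rw [mul_left_cancel₀ (left_ne_zero_of_mul h0) hpj]
  exact homogeneousComponent_isHomogeneous j g

theorem dvd_aeval_sub_aeval {σ S : Type*} [CommRing S] [Algebra k S] {q : S} {x y : σ → S}
    (h : ∀ i, q ∣ x i - y i) (g : MvPolynomial σ k) : q ∣ aeval x g - aeval y g := by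
  induction g using MvPolynomial.induction_on with
  | C a => simp
  | add a b ha hb =>
    rw [map_add, map_add, add_sub_add_comm]
    exact dvd_add ha hb
  | mul_X a i ha =>
    rw [map_mul, map_mul, aeval_X, aeval_X]
    have : aeval x a * x i - aeval y a * y i =
        (aeval x a - aeval y a) * x i + aeval y a * (x i - y i) := by ring
    rw [this]
    exact dvd_add (ha.mul_right _) ((h i).mul_left _)

theorem eq_zero_of_eval_eq_zero_of_ne {σ : Type*} [Infinite k] {G N : MvPolynomial σ k}
    (hN : N ≠ 0) (h : ∀ x, eval x N ≠ 0 → eval x G = 0) : G = 0 := by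
  have : N * G = 0 := by
    refine MvPolynomial.funext fun x => ?_
    rw [map_mul, map_zero]
    by_cases hx : eval x N = 0
    · rw [hx, zero_mul]
    · rw [h x hx, mul_zero]
  exact (mul_eq_zero.mp this).resolve_left hN

theorem eval_aeval {σ τ : Type*} (x : τ → k) (Φ : σ → MvPolynomial τ k) (g : MvPolynomial σ k) :
    eval x (aeval Φ g) = eval (fun i => eval x (Φ i)) g := by
  rw [← coe_aeval_eq_eval, ← coe_aeval_eq_eval]
  exact congrArg (fun f => f g) (comp_aeval Φ (aeval x)) |>.trans rfl

theorem polynomial_eval_aeval {σ : Type*} (x : k) (φ : σ → Polynomial k) (g : MvPolynomial σ k) :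
    (aeval φ g).eval x = eval (fun i => (φ i).eval x) g := by
  rw [← Polynomial.coe_aeval_eq_eval, ← coe_aeval_eq_eval]
  exact congrArg (fun f => f g) (comp_aeval φ (Polynomial.aeval x)) |>.trans rfl

theorem eval_smul_of_isHomogeneous {σ : Type*} {n : ℕ} {g : MvPolynomial σ k}
    (hg : g.IsHomogeneous n) (a : k) (x : σ → k) :
    eval (fun i => a * x i) g = a ^ n * eval x g := by
  rw [← coe_aeval_eq_eval, ← coe_aeval_eq_eval]
  exact aeval_mul_of_isHomogeneous hg a x

/-- The parametrization `t ↦ [1 : u₀ + u₁ t : v₀ + v₁ t]` of a line. -/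
noncomputable def lineParam (u₀ v₀ u₁ v₁ : k) : Fin 3 → Polynomial k :=
  ![1, Polynomial.C u₀ + Polynomial.C u₁ * Polynomial.X,
    Polynomial.C v₀ + Polynomial.C v₁ * Polynomial.X]

/-- The equation of the line through `[1 : u₀ : v₀]` with direction `[0 : u₁ : v₁]`. -/
noncomputable def lineForm (u₀ v₀ u₁ v₁ : k) : MvPolynomial (Fin 3) k :=
  C u₁ * (X 2 - C v₀ * X 0) - C v₁ * (X 1 - C u₀ * X 0)

/-- The forms that vanish on the parametrization of a line are the multiples of its equation. -/
theorem lineForm_dvd_of_aeval_lineParam_eq_zero [Infinite k] {u₀ v₀ u₁ v₁ : k}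
    (hdir : u₁ ≠ 0 ∨ v₁ ≠ 0) {d : ℕ} {h : MvPolynomial (Fin 3) k} (hh : h.IsHomogeneous d)
    (h0 : aeval (lineParam u₀ v₀ u₁ v₁) h = 0) : lineForm u₀ v₀ u₁ v₁ ∣ h := by
  obtain ⟨α, β, hαβ⟩ : ∃ α β : k, α * u₁ + β * v₁ = 1 := by
    rcases hdir with h | h
    · exact ⟨u₁⁻¹, 0, by simp [h]⟩
    · exact ⟨0, v₁⁻¹, by simp [h]⟩
  have hC : (C α * C u₁ + C β * C v₁ : MvPolynomial (Fin 3) k) = 1 := by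
    rw [← C_mul, ← C_mul, ← C_add, hαβ, C_1]
  -- `T` is a linear form with `T = t` at the point with parameter `t`.
  let T : MvPolynomial (Fin 3) k := C α * (X 1 - C u₀ * X 0) + C β * (X 2 - C v₀ * X 0)
  let Φ : Fin 3 → MvPolynomial (Fin 3) k :=
    ![X 0, C u₀ * X 0 + C u₁ * T, C v₀ * X 0 + C v₁ * T]
  have hΦ : aeval Φ h = 0 := by
    refine eq_zero_of_eval_eq_zero_of_ne (X_ne_zero (0 : Fin 3)) fun x hx => ?_
    rw [eval_X] at hx
    have hval : (fun i => eval x (Φ i)) =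
        fun i => x 0 * (lineParam u₀ v₀ u₁ v₁ i).eval (eval x T / x 0) := by
      funext i
      fin_cases i
      · simp [Φ, lineParam]
      · simp only [Φ, lineParam, Fin.mk_one, Matrix.cons_val_one, Matrix.cons_val_zero, map_add,
          map_mul, eval_C, eval_X, Polynomial.eval_add, Polynomial.eval_mul, Polynomial.eval_C,
          Polynomial.eval_X]
        field_simp
      · simp only [Φ, lineParam, Fin.reduceFinMk, Matrix.cons_val, map_add,
          map_mul, eval_C, eval_X, Polynomial.eval_add, Polynomial.eval_mul, Polynomial.eval_C,
          Polynomial.eval_X]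
        field_simp
    rw [eval_aeval, hval, eval_smul_of_isHomogeneous hh, ← polynomial_eval_aeval, h0]
    simp
  have hdvd : ∀ i, lineForm u₀ v₀ u₁ v₁ ∣ X i - Φ i := by
    intro i
    fin_cases i
    · simp [Φ]
    · refine ⟨-C β, ?_⟩
      change X 1 - (C u₀ * X 0 + C u₁ * T) = _
      simp only [T, lineForm]
      linear_combination (-(X 1 - C u₀ * X 0)) * hC
    · refine ⟨C α, ?_⟩
      change X 2 - (C v₀ * X 0 + C v₁ * T) = _
      simp only [T, lineForm]
      linear_combination (-(X 2 - C v₀ * X 0)) * hC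
  have := dvd_aeval_sub_aeval hdvd h
  rwa [hΦ, sub_zero, aeval_X_left_apply] at this

/-- Bézout's inequality for a line: a curve of degree `d` that does not contain the line meets it
with total multiplicity at most `d`. -/
theorem sum_le_of_not_lineForm_dvd [Infinite k] {u₀ v₀ u₁ v₁ : k} (hdir : u₁ ≠ 0 ∨ v₁ ≠ 0)
    {d : ℕ} {h : MvPolynomial (Fin 3) k} (hh : h.IsHomogeneous d)
    (hndvd : ¬ lineForm u₀ v₀ u₁ v₁ ∣ h) {ι : Type*} (s : Finset ι) (t : ι → k)
    (ht : Set.InjOn t s) (n : ι → ℕ)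
    (hmem : ∀ i ∈ s, h ∈ fatPointIdeal (affinePoint (u₀ + u₁ * t i) (v₀ + v₁ * t i)) (n i)) :
    ∑ i ∈ s, n i ≤ d := by
  have h0 : aeval (lineParam u₀ v₀ u₁ v₁) h ≠ 0 :=
    fun h0 => hndvd (lineForm_dvd_of_aeval_lineParam_eq_zero hdir hh h0)
  have hdvd : ∏ i ∈ s, (Polynomial.X - Polynomial.C (t i)) ^ n i ∣
      aeval (lineParam u₀ v₀ u₁ v₁) h := by
    refine Finset.prod_dvd_of_coprime (fun i hi j hj hij => ?_) fun i hi => ?_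
    · exact (Polynomial.isCoprime_X_sub_C_of_isUnit_sub
        (sub_ne_zero.mpr fun he => hij (ht hi hj he)).isUnit).pow
    · refine pow_dvd_of_mem_fatPointIdeal (aeval (lineParam u₀ v₀ u₁ v₁)).toRingHom
        ⟨Polynomial.C u₁, ?_⟩ ⟨Polynomial.C v₁, ?_⟩ (hmem i hi)
      · simp [lineParam]; ring
      · simp [lineParam]; ring
  have hdeg := Polynomial.natDegree_le_of_dvd hdvd h0
  have hle : (aeval (lineParam u₀ v₀ u₁ v₁) h).natDegree ≤ d * 1 := by
    refine aeval_natDegree_le h hh.totalDegree_le _ fun i => ?_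
    fin_cases i
    · simp [lineParam]
    · simp only [lineParam, Fin.mk_one, Matrix.cons_val_one, Matrix.cons_val_zero]
      compute_degree
    · simp only [lineParam, Fin.reduceFinMk, Matrix.cons_val]
      compute_degree
  rw [Polynomial.natDegree_prod_of_monic _ _
    fun i _ => (Polynomial.monic_X_sub_C (t i)).pow (n i)] at hdeg
  simp only [Polynomial.natDegree_pow, Polynomial.natDegree_X_sub_C, mul_one] at hdeg hle
  exact hdeg.trans hle

end Restriction

/-! ### Two products of linear binary forms and the quotient of their difference -/

section BinaryForms

variable {S T : Type*} [CommRing S] [CommRing T]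

/-- The binary form `∏ (2 y + (2 i + 1) z)`. -/
def oddProd (b : ℕ) (y z : S) : S := ∏ i ∈ Finset.range b, (2 * y + (2 * (i : S) + 1) * z)

/-- The binary form `∏ (2 y + 2 i z)`. -/
def evenProd (b : ℕ) (y z : S) : S := ∏ i ∈ Finset.range b, (2 * y + 2 * (i : S) * z)

/-- The binary form `(oddProd b y z - evenProd b y z) / z`, of degree `b - 1`. It is given by the
recursion of a telescoping difference of products, which avoids the division. -/
def prodDiffQuot : ℕ → S → S → S
  | 0, _, _ => 0
  | b + 1, y, z => prodDiffQuot b y z * (2 * y + 2 * (b : S) * z) + oddProd b y z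

theorem mul_prodDiffQuot (b : ℕ) (y z : S) :
    z * prodDiffQuot b y z = oddProd b y z - evenProd b y z := by
  induction b with
  | zero => simp [prodDiffQuot, oddProd, evenProd]
  | succ b ih =>
    have ho : oddProd (b + 1) y z = oddProd b y z * (2 * y + (2 * (b : S) + 1) * z) :=
      Finset.prod_range_succ _ _
    have he : evenProd (b + 1) y z = evenProd b y z * (2 * y + 2 * (b : S) * z) :=
      Finset.prod_range_succ _ _
    rw [ho, he, prodDiffQuot]
    linear_combination (2 * y + 2 * (b : S) * z) * ih

theorem map_oddProd {F : Type*} [FunLike F S T] [RingHomClass F S T] (φ : F) (b : ℕ) (y z : S) :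
    φ (oddProd b y z) = oddProd b (φ y) (φ z) := by
  simp [oddProd, map_prod, map_ofNat φ 2]

theorem map_prodDiffQuot {F : Type*} [FunLike F S T] [RingHomClass F S T] (φ : F) (b : ℕ)
    (y z : S) : φ (prodDiffQuot b y z) = prodDiffQuot b (φ y) (φ z) := by
  induction b with
  | zero => simp [prodDiffQuot]
  | succ b ih => simp [prodDiffQuot, map_oddProd, ih, map_ofNat φ 2]

theorem oddProd_mul_mul (b : ℕ) (a y z : S) :
    oddProd b (a * y) (a * z) = a ^ b * oddProd b y z := by
  have : a ^ b = ∏ _i ∈ Finset.range b, a := by simp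
  rw [oddProd, oddProd, this, ← Finset.prod_mul_distrib]
  exact Finset.prod_congr rfl fun i _ => by ring

theorem prodDiffQuot_succ_mul_mul (b : ℕ) (a y z : S) :
    prodDiffQuot (b + 1) (a * y) (a * z) = a ^ b * prodDiffQuot (b + 1) y z := by
  induction b with
  | zero => simp [prodDiffQuot, oddProd]
  | succ b ih =>
    rw [prodDiffQuot, ih, oddProd_mul_mul, prodDiffQuot.eq_2 y z (b + 1)]
    ring

theorem oddProd_eq_zero {b : ℕ} {y z : S} (i : ℕ) (hi : i < b)
    (h : 2 * y + (2 * (i : S) + 1) * z = 0) : oddProd b y z = 0 :=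
  Finset.prod_eq_zero (Finset.mem_range.mpr hi) h

theorem evenProd_eq_zero {b : ℕ} {y z : S} (i : ℕ) (hi : i < b)
    (h : 2 * y + 2 * (i : S) * z = 0) : evenProd b y z = 0 :=
  Finset.prod_eq_zero (Finset.mem_range.mpr hi) h

variable {k σ : Type*} [Field k]

theorem isHomogeneous_natCast_mul {n : ℕ} (c : ℕ) {g : MvPolynomial σ k}
    (hg : g.IsHomogeneous n) : ((c : MvPolynomial σ k) * g).IsHomogeneous n := by
  rw [← map_natCast C]
  exact hg.C_mul _

theorem isHomogeneous_oddProd (b : ℕ) {y z : MvPolynomial σ k} (hy : y.IsHomogeneous 1)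
    (hz : z.IsHomogeneous 1) : (oddProd b y z).IsHomogeneous b := by
  have := IsHomogeneous.prod (Finset.range b)
    (fun i : ℕ => 2 * y + (2 * (i : MvPolynomial σ k) + 1) * z) (fun _ => 1) fun i _ => by
      have h := (isHomogeneous_natCast_mul 2 hy).add (isHomogeneous_natCast_mul (2 * i + 1) hz)
      simpa using h
  simpa [oddProd] using this

theorem isHomogeneous_prodDiffQuot_succ (b : ℕ) {y z : MvPolynomial σ k} (hy : y.IsHomogeneous 1)
    (hz : z.IsHomogeneous 1) : (prodDiffQuot (b + 1) y z).IsHomogeneous b := by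
  induction b with
  | zero => simpa [prodDiffQuot, oddProd] using isHomogeneous_one σ k
  | succ b ih =>
    rw [prodDiffQuot]
    refine (ih.mul ?_).add (isHomogeneous_oddProd (b + 1) hy hz)
    have h := (isHomogeneous_natCast_mul 2 hy).add (isHomogeneous_natCast_mul (2 * (b + 1)) hz)
    simpa using h

theorem natDegree_oddProd_le (b : ℕ) :
    (oddProd b Polynomial.X (1 : Polynomial k)).natDegree ≤ b ∧
      (oddProd b Polynomial.X (1 : Polynomial k)).coeff b = 2 ^ b := by
  induction b with
  | zero => simp [oddProd]
  | succ b ih =>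
    have ho : oddProd (b + 1) Polynomial.X (1 : Polynomial k) = oddProd b Polynomial.X 1 *
        (Polynomial.C 2 * Polynomial.X + Polynomial.C (2 * (b : k) + 1)) := by
      rw [oddProd, Finset.prod_range_succ]
      simp [oddProd, map_ofNat Polynomial.C 2]
    have hl : (Polynomial.C 2 * Polynomial.X + Polynomial.C (2 * (b : k) + 1)).natDegree ≤ 1 :=
      Polynomial.natDegree_linear_le
    rw [ho]
    refine ⟨Polynomial.natDegree_mul_le_of_le ih.1 hl, ?_⟩
    rw [Polynomial.coeff_mul_add_eq_of_natDegree_le ih.1 hl, ih.2]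
    simp [pow_succ, Polynomial.coeff_one]

theorem natDegree_prodDiffQuot_succ_le (b : ℕ) :
    (prodDiffQuot (b + 1) Polynomial.X (1 : Polynomial k)).natDegree ≤ b ∧
      (prodDiffQuot (b + 1) Polynomial.X (1 : Polynomial k)).coeff b = (b + 1) * 2 ^ b := by
  induction b with
  | zero => simp [oddProd, prodDiffQuot]
  | succ b ih =>
    have ho : prodDiffQuot (b + 1 + 1) Polynomial.X (1 : Polynomial k) =
        prodDiffQuot (b + 1) Polynomial.X 1 *
          (Polynomial.C 2 * Polynomial.X + Polynomial.C (2 * ((b + 1 : ℕ) : k))) +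
        oddProd (b + 1) Polynomial.X 1 := by
      rw [prodDiffQuot]
      simp [map_ofNat Polynomial.C 2]
    have hl : (Polynomial.C 2 * Polynomial.X +
        Polynomial.C (2 * ((b + 1 : ℕ) : k))).natDegree ≤ 1 :=
      Polynomial.natDegree_linear_le
    rw [ho]
    refine ⟨Polynomial.natDegree_add_le_of_degree_le (Polynomial.natDegree_mul_le_of_le ih.1 hl)
      (natDegree_oddProd_le _).1, ?_⟩
    rw [Polynomial.coeff_add, (natDegree_oddProd_le _).2,
      Polynomial.coeff_mul_add_eq_of_natDegree_le ih.1 hl, ih.2]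
    simp [Polynomial.coeff_one]
    ring

theorem isCoprime_two_mul_X_add_C {c c' : k} (h : c ≠ c') :
    IsCoprime (2 * Polynomial.X + Polynomial.C c) (2 * Polynomial.X + Polynomial.C c') := by
  refine ⟨Polynomial.C (c - c')⁻¹, -Polynomial.C (c - c')⁻¹, ?_⟩
  have : Polynomial.C (c - c')⁻¹ * (Polynomial.C c - Polynomial.C c') = 1 := by
    rw [← Polynomial.C_sub, ← Polynomial.C_mul, inv_mul_cancel₀ (sub_ne_zero.mpr h),
      Polynomial.C_1]
  linear_combination this

variable [CharZero k]

theorem natDegree_prodDiffQuot_succ (b : ℕ) :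
    (prodDiffQuot (b + 1) Polynomial.X (1 : Polynomial k)).natDegree = b := by
  refine Polynomial.natDegree_eq_of_le_of_coeff_ne_zero (natDegree_prodDiffQuot_succ_le b).1 ?_
  rw [(natDegree_prodDiffQuot_succ_le b).2]
  exact mul_ne_zero (by exact_mod_cast b.succ_ne_zero) (pow_ne_zero _ two_ne_zero)
theorem odd_ne_even_cast (i j : ℕ) : (2 * (i : k) + 1) ≠ 2 * (j : k) := by
  intro h
  have : 2 * i + 1 = 2 * j := by exact_mod_cast h
  omega

theorem isRelPrime_oddProd_evenProd (b : ℕ) :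
    IsRelPrime (oddProd b (X 0) (X 1) : MvPolynomial (Fin 2) k) (evenProd b (X 0) (X 1)) := by
  have hX : IsRelPrime (X 0 : MvPolynomial (Fin 2) k) (X 1) := by
    intro d h0 h1
    rcases (X_prime (R := k) (i := (0 : Fin 2))).irreducible.dvd_iff.mp h0 with hu | ha
    · exact hu
    · have := X_dvd_X.mp (ha.dvd.trans h1)
      simp at this
  refine IsRelPrime.prod_left fun i _ => IsRelPrime.prod_right fun j _ d hi hj => ?_
  have hc : (2 * (i : k) + 1) - 2 * (j : k) ≠ 0 := sub_ne_zero.mpr (odd_ne_even_cast i j)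
  have hunit : ∀ c : k, c ≠ 0 → IsUnit (C c : MvPolynomial (Fin 2) k) :=
    fun c hc => (IsUnit.mk0 c hc).map C
  have h1 : d ∣ X 1 := by
    refine (hunit _ hc).dvd_mul_left.mp ?_
    convert dvd_sub hi hj using 1
    simp [map_ofNat (C (σ := Fin 2) (R := k)) 2]
    ring
  refine hX ((hunit 2 two_ne_zero).dvd_mul_left.mp ?_) h1
  convert dvd_sub hj (h1.mul_left (2 * (j : MvPolynomial (Fin 2) k))) using 1
  simp [map_ofNat (C (σ := Fin 2) (R := k)) 2]

end BinaryForms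

/-! ### The rational curve -/

section RationalCurve

variable {k : Type*} [Field k]

/-- The equation of the curve of degree `b` through the points `[1 : 2 i + 1 : 0]` and `[1 : i : 1]`
that has multiplicity `b - 1` at `[1 : 0 : 2]`. In the coordinates `y = x₁`, `z = x₂ - 2 x₀` at that
point and `w = x₂` it is `w A(y, z) + B(y, z)`, where `B = oddProd b` cuts out the points on
`w = 0`, and where `A = (B - E) / z` with `E = evenProd b`, because the restriction to `w = -z`
has to be `E`. -/
noncomputable def rationalCurve (k : Type*) [Field k] (b : ℕ) : MvPolynomial (Fin 3) k :=
  X 2 * prodDiffQuot b (X 1) (X 2 - 2 * X 0) + oddProd b (X 1) (X 2 - 2 * X 0)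

theorem isHomogeneous_X_two_sub :
    (X 2 - 2 * X 0 : MvPolynomial (Fin 3) k).IsHomogeneous 1 :=
  (isHomogeneous_X _ _).sub (by simpa using isHomogeneous_natCast_mul 2 (isHomogeneous_X k _))

theorem isHomogeneous_rationalCurve (b : ℕ) : (rationalCurve k (b + 1)).IsHomogeneous (b + 1) := by
  have h := (isHomogeneous_X k (2 : Fin 3)).mul
    (isHomogeneous_prodDiffQuot_succ b (isHomogeneous_X k (1 : Fin 3)) isHomogeneous_X_two_sub)
  rw [add_comm 1 b] at h
  exact h.add (isHomogeneous_oddProd _ (isHomogeneous_X k (1 : Fin 3)) isHomogeneous_X_two_sub)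

variable [CharZero k]

theorem prodDiffQuot_succ_X_ne_zero (b : ℕ) :
    prodDiffQuot (b + 1) (X 1 : MvPolynomial (Fin 3) k) (X 2 - 2 * X 0) ≠ 0 := by
  intro h
  have h1 := congrArg (aeval (R := k) ![0, Polynomial.X, (1 : Polynomial k)]) h
  rw [map_prodDiffQuot] at h1
  simp only [map_zero, aeval_X, map_sub, map_mul, Matrix.cons_val, mul_zero, sub_zero] at h1
  have h2 := (natDegree_prodDiffQuot_succ_le (k := k) b).2
  rw [h1, Polynomial.coeff_zero] at h2
  exact mul_ne_zero (by exact_mod_cast b.succ_ne_zero) (pow_ne_zero b two_ne_zero) h2.symm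

/-- In the coordinates `y`, `z`, `w` the equation has degree one in `w`, with coefficients that are
relatively prime. -/
theorem irreducible_rationalCurve (b : ℕ) : Irreducible (rationalCurve k (b + 1)) := by
  let F : MvPolynomial (Fin 3) k →ₐ[k] Polynomial (MvPolynomial (Fin 2) k) :=
    aeval ![Polynomial.C (C 2⁻¹) * (Polynomial.X - Polynomial.C (X 1)), Polynomial.C (X 0),
      Polynomial.X]
  let G : Polynomial (MvPolynomial (Fin 2) k) →+* MvPolynomial (Fin 3) k :=
    Polynomial.eval₂RingHom (aeval ![X 1, X 2 - 2 * X 0]).toRingHom (X 2)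
  have h2 : (C 2⁻¹ * 2 : MvPolynomial (Fin 2) k) = 1 := by
    rw [← map_ofNat C 2, ← C_mul, inv_mul_cancel₀ two_ne_zero, C_1]
  have h2' : (C 2⁻¹ * 2 : MvPolynomial (Fin 3) k) = 1 := by
    rw [← map_ofNat C 2, ← C_mul, inv_mul_cancel₀ two_ne_zero, C_1]
  have h2p : (Polynomial.C (C 2⁻¹) * 2 : Polynomial (MvPolynomial (Fin 2) k)) = 1 := by
    rw [← map_ofNat Polynomial.C 2, ← Polynomial.C_mul, h2, Polynomial.C_1]
  have hFz : F (X 2 - 2 * X 0) = Polynomial.C (X 1) := by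
    simp only [F, map_sub, map_mul, map_ofNat, aeval_X, Matrix.cons_val]
    linear_combination (Polynomial.C (X 1) - Polynomial.X) * h2p
  have hGF : G.comp F.toRingHom = RingHom.id _ := by
    apply MvPolynomial.ringHom_ext
    · intro a
      simp [F, G, IsScalarTower.algebraMap_eq k (MvPolynomial (Fin 2) k) (Polynomial _)]
    · intro i
      fin_cases i
      · simp [F, G]
        linear_combination (X 0) * h2'
      · simp [F, G]
      · simp [F, G]
  have hFG : F.toRingHom.comp G = RingHom.id _ := by
    apply Polynomial.ringHom_ext'
    · apply MvPolynomial.ringHom_ext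
      · intro a
        simp [F, G, IsScalarTower.algebraMap_eq k (MvPolynomial (Fin 2) k) (Polynomial _)]
      · intro i
        fin_cases i
        · simp [F, G]
        · simpa [G] using hFz
    · simp [F, G]
  let e := RingEquiv.ofRingHom F.toRingHom G hFG hGF
  rw [← MulEquiv.irreducible_iff e]
  have he : e (rationalCurve k (b + 1)) =
      Polynomial.C (prodDiffQuot (b + 1) (X 0) (X 1)) * Polynomial.X +
        Polynomial.C (oddProd (b + 1) (X 0) (X 1)) := by
    change F _ = _
    have hy : F (X 1) = Polynomial.C (X 0) := by simp [F]
    have hw : F (X 2) = Polynomial.X := by simp [F]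
    rw [rationalCurve, map_add, map_mul, map_prodDiffQuot, map_oddProd, hFz, hy, hw,
      map_prodDiffQuot, map_oddProd, mul_comm]
  rw [he]
  refine Polynomial.irreducible_C_mul_X_add_C ?_ ?_
  · intro h
    have h1 := congrArg (aeval (R := k) ![Polynomial.X, (1 : Polynomial k)]) h
    rw [map_prodDiffQuot] at h1
    simp only [map_zero, aeval_X, Matrix.cons_val_zero, Matrix.cons_val_one] at h1
    have h2 := (natDegree_prodDiffQuot_succ_le (k := k) b).2
    rw [h1, Polynomial.coeff_zero] at h2
    exact mul_ne_zero (by exact_mod_cast b.succ_ne_zero) (pow_ne_zero b two_ne_zero) h2.symm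
  · intro d hA hB
    refine isRelPrime_oddProd_evenProd (k := k) (b + 1) hB ?_
    have := mul_prodDiffQuot (b + 1) (X 0 : MvPolynomial (Fin 2) k) (X 1)
    have h3 : evenProd (b + 1) (X 0 : MvPolynomial (Fin 2) k) (X 1) =
        oddProd (b + 1) (X 0) (X 1) - X 1 * prodDiffQuot (b + 1) (X 0) (X 1) := by
      rw [this]; ring
    rw [h3]
    exact dvd_sub hB (hA.mul_left _)

/-- A form of smaller degree is not divisible by the equation of the curve. -/
theorem not_rationalCurve_dvd_prodDiffQuot (b : ℕ) :
    ¬ rationalCurve k (b + 1) ∣ prodDiffQuot (b + 1) (X 1) (X 2 - 2 * X 0) := by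
  intro h
  have h1 := totalDegree_le_of_dvd_of_isDomain h (prodDiffQuot_succ_X_ne_zero b)
  rw [(isHomogeneous_rationalCurve b).totalDegree (irreducible_rationalCurve b).ne_zero] at h1
  have h2 := (isHomogeneous_prodDiffQuot_succ b (isHomogeneous_X k (1 : Fin 3))
    isHomogeneous_X_two_sub).totalDegree_le
  omega

/-- The rational parametrization `[y : z] ↦ [-(B + z A) : 2 y A : -2 B]` of the curve
`w A + B = 0`, which comes from `[y : z : w] = [y A : z A : -B]`. -/
def curveParam {S : Type*} [CommRing S] (b : ℕ) (y z : S) : Fin 3 → S :=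
  ![-(oddProd b y z + z * prodDiffQuot b y z), 2 * y * prodDiffQuot b y z, -2 * oddProd b y z]

/-- The forms that vanish on the parametrization are the multiples of the equation: modulo
`w A + B` the parametrization is `2 A` times the point itself, so a form `h` of degree `d` that
vanishes on it satisfies `(2 A) ^ d h = 0` modulo the equation, which is prime to `A`. -/
theorem rationalCurve_dvd_of_aeval_curveParam_eq_zero (b : ℕ) {d : ℕ} {h : MvPolynomial (Fin 3) k}
    (hh : h.IsHomogeneous d)
    (h0 : aeval (curveParam (b + 1) Polynomial.X (1 : Polynomial k)) h = 0) :
    rationalCurve k (b + 1) ∣ h := by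
  let y : MvPolynomial (Fin 3) k := X 1
  let z : MvPolynomial (Fin 3) k := X 2 - 2 * X 0
  let A := prodDiffQuot (b + 1) y z
  have hz : z ≠ 0 := by
    intro hz
    have := congrArg (eval ![0, 0, 1]) hz
    simp [z] at this
  -- The binary form `h (curveParam y z)` vanishes since its dehomogenization does.
  have hG : aeval (curveParam (b + 1) y z) h = 0 := by
    refine eq_zero_of_eval_eq_zero_of_ne hz fun x hx => ?_
    have hval : (fun i => eval x (curveParam (b + 1) y z i)) = fun i => eval x z ^ (b + 1) *
        (curveParam (b + 1) Polynomial.X (1 : Polynomial k) i).eval (eval x y / eval x z) := by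
      have hA := prodDiffQuot_succ_mul_mul b (eval x z) (eval x y / eval x z) 1
      have hB := oddProd_mul_mul (b + 1) (eval x z) (eval x y / eval x z) 1
      rw [mul_one, mul_div_cancel₀ _ hx] at hA hB
      have hpA : (prodDiffQuot (b + 1) Polynomial.X (1 : Polynomial k)).eval
          (eval x y / eval x z) = prodDiffQuot (b + 1) (eval x y / eval x z) 1 := by
        rw [← Polynomial.coe_evalRingHom, map_prodDiffQuot]
        simp
      have hpB : (oddProd (b + 1) Polynomial.X (1 : Polynomial k)).eval
          (eval x y / eval x z) = oddProd (b + 1) (eval x y / eval x z) 1 := by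
        rw [← Polynomial.coe_evalRingHom, map_oddProd]
        simp
      funext i
      fin_cases i
      · simp [curveParam, map_prodDiffQuot, map_oddProd, hA, hB, hpA, hpB]
        ring
      · simp [curveParam, map_prodDiffQuot, hA, hpA]
        field_simp
        ring
      · simp [curveParam, map_oddProd, hB, hpB]
        ring
    rw [eval_aeval, hval, eval_smul_of_isHomogeneous hh, ← polynomial_eval_aeval, h0]
    simp
  have hdvd : ∀ i, rationalCurve k (b + 1) ∣ 2 * A * X i - curveParam (b + 1) y z i := by
    intro i
    fin_cases i
    · refine ⟨1, ?_⟩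
      simp [curveParam, rationalCurve, A, y, z]
      ring
    · refine ⟨0, ?_⟩
      simp [curveParam, A, y, z]
      ring
    · refine ⟨2, ?_⟩
      simp [curveParam, rationalCurve, A, y, z]
      ring
  have hd := dvd_aeval_sub_aeval hdvd h
  rw [hG, sub_zero, aeval_mul_of_isHomogeneous hh, aeval_X_left_apply] at hd
  have hp := (irreducible_rationalCurve (k := k) b).prime
  refine (hp.dvd_or_dvd hd).resolve_left fun hpow => ?_
  have h2 : IsUnit (2 : MvPolynomial (Fin 3) k) := by
    rw [← map_ofNat C 2]
    exact (IsUnit.mk0 (2 : k) two_ne_zero).map C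
  exact not_rationalCurve_dvd_prodDiffQuot b (h2.dvd_mul_left.mp (hp.dvd_of_dvd_pow hpow))

/-- Bézout's inequality for the rational curve of degree `b + 1`: a curve of degree `d` that does
not contain it has at most `(b + 1) d` intersections with it, counted at its `2 (b + 1)` simple
points and at its point of multiplicity `b`. -/
theorem sum_add_sum_add_le_of_not_rationalCurve_dvd (b : ℕ) {d : ℕ} {h : MvPolynomial (Fin 3) k}
    (hh : h.IsHomogeneous d) (hndvd : ¬ rationalCurve k (b + 1) ∣ h) (p q : ℕ → ℕ) (r : ℕ)
    (hp : ∀ i < b + 1, h ∈ fatPointIdeal (affinePoint (2 * (i : k) + 1) 0) (p i))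
    (hq : ∀ i < b + 1, h ∈ fatPointIdeal (affinePoint (i : k) 1) (q i))
    (hr : h ∈ fatPointIdeal (affinePoint 0 2) r) :
    ∑ i ∈ Finset.range (b + 1), p i + ∑ i ∈ Finset.range (b + 1), q i + b * r ≤ d * (b + 1) := by
  set x : Polynomial k := Polynomial.X
  set A := prodDiffQuot (b + 1) x 1 with hA
  set B := oddProd (b + 1) x 1 with hB
  set E := evenProd (b + 1) x 1 with hE
  have hABE : A = B - E := by rw [hA, hB, hE, ← mul_prodDiffQuot, one_mul]
  let φ : MvPolynomial (Fin 3) k →ₐ[k] Polynomial k := aeval (curveParam (b + 1) x 1)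
  have hφ0 : φ (X 0) = -(B + A) := by simp [φ, curveParam, hA, hB]
  have hφ1 : φ (X 1) = 2 * x * A := by simp [φ, curveParam, hA]
  have hφ2 : φ (X 2) = -2 * B := by simp [φ, curveParam, hB]
  have h0 : φ h ≠ 0 := fun h0 => hndvd (rationalCurve_dvd_of_aeval_curveParam_eq_zero b hh h0)
  let o : ℕ → Polynomial k := fun i => 2 * x + Polynomial.C (2 * (i : k) + 1)
  let e : ℕ → Polynomial k := fun i => 2 * x + Polynomial.C (2 * (i : k))
  have ho : ∀ i, o i = 2 * x + (2 * (i : Polynomial k) + 1) * 1 := by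
    intro i
    simp [o, map_ofNat Polynomial.C 2]
  have he : ∀ i, e i = 2 * x + 2 * (i : Polynomial k) * 1 := by
    intro i
    simp [e, map_ofNat Polynomial.C 2]
  have hoB : ∀ i < b + 1, o i ∣ B := fun i hi => by
    rw [ho]
    exact Finset.dvd_prod_of_mem _ (Finset.mem_range.mpr hi)
  have heE : ∀ i < b + 1, e i ∣ E := fun i hi => by
    rw [he]
    exact Finset.dvd_prod_of_mem _ (Finset.mem_range.mpr hi)
  have hoe : ∀ i j, IsCoprime (o i) (e j) := fun i j =>
    isCoprime_two_mul_X_add_C (odd_ne_even_cast i j)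
  have hBE : IsCoprime B E := IsCoprime.prod_left fun i _ => IsCoprime.prod_right fun j _ => by
    rw [← ho, ← he]
    exact hoe i j
  have hAB : IsCoprime A B := by
    rw [hABE, show B - E = -E + B * 1 by ring]
    exact hBE.symm.neg_left.add_mul_left_left 1
  have hAE : IsCoprime A E := by
    rw [hABE, show B - E = B + E * (-1) by ring]
    exact hBE.add_mul_left_left (-1)
  have hP : ∏ i ∈ Finset.range (b + 1), o i ^ p i ∣ φ h := by
    refine Finset.prod_dvd_of_coprime (fun i _ j _ hij => ?_) fun i hi => ?_
    · refine (isCoprime_two_mul_X_add_C fun hc => hij ?_).pow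
      have : 2 * i + 1 = 2 * j + 1 := by exact_mod_cast hc
      omega
    · have hi' := Finset.mem_range.mp hi
      refine pow_dvd_of_mem_fatPointIdeal φ.toRingHom ?_ ?_ (hp i hi')
      · change o i ∣ φ _
        have : φ (X 1 - C (2 * (i : k) + 1) * X 0) =
            A * o i + (2 * (i : Polynomial k) + 1) * B := by
          rw [map_sub, map_mul, hφ0, hφ1, ho]
          simp [φ, map_ofNat Polynomial.C 2]
          ring
        rw [this]
        exact dvd_add (dvd_mul_left _ _) ((hoB i hi').mul_left _)
      · change o i ∣ φ _
        have : φ (X 2 - C 0 * X 0) = -2 * B := by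
          rw [C_0, zero_mul, sub_zero, hφ2]
        rw [this]
        exact (hoB i hi').mul_left _
  have hQ : ∏ i ∈ Finset.range (b + 1), e i ^ q i ∣ φ h := by
    refine Finset.prod_dvd_of_coprime (fun i _ j _ hij => ?_) fun i hi => ?_
    · refine (isCoprime_two_mul_X_add_C fun hc => hij ?_).pow
      have : 2 * i = 2 * j := by exact_mod_cast hc
      omega
    · have hi' := Finset.mem_range.mp hi
      refine pow_dvd_of_mem_fatPointIdeal φ.toRingHom ?_ ?_ (hq i hi')
      · change e i ∣ φ _
        have : φ (X 1 - C (i : k) * X 0) = A * e i + (i : Polynomial k) * E := by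
          rw [map_sub, map_mul, hφ0, hφ1, he, hABE]
          simp [φ]
          ring
        rw [this]
        exact dvd_add (dvd_mul_left _ _) ((heE i hi').mul_left _)
      · change e i ∣ φ _
        have : φ (X 2 - C 1 * X 0) = -E := by
          rw [C_1, one_mul, map_sub, hφ2, hφ0, hABE]
          ring
        rw [this]
        exact (heE i hi').neg_right
  -- All `b` zeros of `A` are mapped to the point of multiplicity `b`.
  have hR : A ^ r ∣ φ h := by
    refine pow_dvd_of_mem_fatPointIdeal φ.toRingHom ?_ ?_ hr
    · change A ∣ φ _
      rw [C_0, zero_mul, sub_zero, hφ1]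
      exact dvd_mul_left _ _
    · change A ∣ φ _
      have : φ (X 2 - C 2 * X 0) = 2 * A := by
        rw [map_sub, map_mul, hφ2, hφ0, map_ofNat C 2, map_ofNat φ 2]
        ring
      rw [this]
      exact dvd_mul_left _ _
  have hPQ : IsCoprime (∏ i ∈ Finset.range (b + 1), o i ^ p i)
      (∏ i ∈ Finset.range (b + 1), e i ^ q i) :=
    IsCoprime.prod_left fun i _ => IsCoprime.prod_right fun j _ => (hoe i j).pow
  have hPQR : IsCoprime ((∏ i ∈ Finset.range (b + 1), o i ^ p i) *
      ∏ i ∈ Finset.range (b + 1), e i ^ q i) (A ^ r) := by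
    refine IsCoprime.mul_left (IsCoprime.prod_left fun i hi => ?_)
      (IsCoprime.prod_left fun i hi => ?_)
    · exact (hAB.symm.of_isCoprime_of_dvd_left (hoB i (Finset.mem_range.mp hi))).pow
    · exact (hAE.symm.of_isCoprime_of_dvd_left (heE i (Finset.mem_range.mp hi))).pow
  have hdeg := Polynomial.natDegree_le_of_dvd (hPQR.mul_dvd (hPQ.mul_dvd hP hQ) hR) h0
  have hlin : ∀ c : k, (2 * x + Polynomial.C c).natDegree = 1 ∧ 2 * x + Polynomial.C c ≠ 0 := by
    intro c
    have : (2 * x + Polynomial.C c).natDegree = 1 := by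
      rw [← map_ofNat Polynomial.C 2]
      exact Polynomial.natDegree_linear two_ne_zero
    exact ⟨this, fun h => by rw [h, Polynomial.natDegree_zero] at this; exact zero_ne_one this⟩
  have hAdeg : A.natDegree = b := natDegree_prodDiffQuot_succ b
  have hA0 : A ≠ 0 := by
    intro h
    have h2 := (natDegree_prodDiffQuot_succ_le (k := k) b).2
    change A.coeff b = _ at h2
    rw [h, Polynomial.coeff_zero] at h2
    exact mul_ne_zero (by exact_mod_cast b.succ_ne_zero) (pow_ne_zero b two_ne_zero) h2.symm
  have hPne : ∀ i ∈ Finset.range (b + 1), o i ^ p i ≠ 0 := fun i _ => pow_ne_zero _ (hlin _).2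
  have hQne : ∀ i ∈ Finset.range (b + 1), e i ^ q i ≠ 0 := fun i _ => pow_ne_zero _ (hlin _).2
  rw [Polynomial.natDegree_mul (mul_ne_zero (Finset.prod_ne_zero_iff.mpr hPne)
      (Finset.prod_ne_zero_iff.mpr hQne)) (pow_ne_zero _ hA0),
    Polynomial.natDegree_mul (Finset.prod_ne_zero_iff.mpr hPne) (Finset.prod_ne_zero_iff.mpr hQne),
    Polynomial.natDegree_prod _ _ hPne, Polynomial.natDegree_prod _ _ hQne] at hdeg
  simp only [Polynomial.natDegree_pow, hAdeg, o, e, (hlin _).1, mul_one] at hdeg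
  have hle : (φ h).natDegree ≤ d * (b + 1) := by
    refine aeval_natDegree_le h hh.totalDegree_le _ fun i => ?_
    have hBle : B.natDegree ≤ b + 1 := (natDegree_oddProd_le (b + 1)).1
    have h2 : ∀ f : Polynomial k, (2 * f).natDegree ≤ f.natDegree := fun f => by
      rw [← map_ofNat Polynomial.C 2]
      exact Polynomial.natDegree_C_mul_le _ _
    fin_cases i
    · simp only [curveParam, Fin.zero_eta, Matrix.cons_val_zero, one_mul, Polynomial.natDegree_neg]
      exact Polynomial.natDegree_add_le_of_degree_le hBle (by change A.natDegree ≤ _; omega)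
    · simp only [curveParam, Fin.mk_one, Matrix.cons_val_one, Matrix.cons_val_zero]
      rw [mul_assoc]
      refine (h2 _).trans ?_
      have := Polynomial.natDegree_mul_le_of_le (Polynomial.natDegree_X_le (R := k)) hAdeg.le
      rwa [add_comm 1 b] at this
    · simp only [curveParam, Fin.reduceFinMk, Matrix.cons_val, neg_mul, Polynomial.natDegree_neg]
      exact (h2 _).trans hBle
  rw [mul_comm b r]
  exact hdeg.trans hle

end RationalCurve

/-! ### Multiplicities of the components of the extremal curve -/

section Components

variable {k : Type*} [Field k]

/-- The line through `[1 : 2 i : 0]`, `[1 : i : 1]` and `[1 : 0 : 2]`. -/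
noncomputable def connectingLine (k : Type*) [Field k] (i : ℕ) : MvPolynomial (Fin 3) k :=
  X 1 + C (i : k) * (X 2 - 2 * X 0)

theorem isHomogeneous_connectingLine (i : ℕ) : (connectingLine k i).IsHomogeneous 1 :=
  (isHomogeneous_X _ _).add (isHomogeneous_X_two_sub.C_mul _)

theorem connectingLine_ne_zero (i : ℕ) : connectingLine k i ≠ 0 := by
  intro h
  have := congrArg (eval ![0, 1, 0]) h
  simp [connectingLine] at this

theorem isHomogeneous_X_two_sub_X_zero : (X 2 - X 0 : MvPolynomial (Fin 3) k).IsHomogeneous 1 :=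
  (isHomogeneous_X _ _).sub (isHomogeneous_X _ _)

theorem X_two_sub_X_zero_ne_zero : (X 2 - X 0 : MvPolynomial (Fin 3) k) ≠ 0 := by
  intro h
  have := congrArg (eval ![0, 0, 1]) h
  simp at this

theorem hasMultiplicityAt_X_two_zero (u : k) : HasMultiplicityAt (X 2) (affinePoint u 0) 1 :=
  hasMultiplicityAt_of_contraction_eq (q := Polynomial.C (X 2)) (by simp)
    (by simp [X_ne_zero])

theorem hasMultiplicityAt_X_two {u v : k} (hv : v ≠ 0) :
    HasMultiplicityAt (X 2) (affinePoint u v) 0 :=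
  (hasMultiplicityAt_zero_iff (isHomogeneous_X k 2)).mpr (by simpa using hv)

theorem hasMultiplicityAt_X_two_sub_X_zero_one (u : k) :
    HasMultiplicityAt (X 2 - X 0) (affinePoint u 1) 1 :=
  hasMultiplicityAt_of_contraction_eq (q := Polynomial.C (X 2 - X 0)) (by simp)
    (by simpa using X_two_sub_X_zero_ne_zero)

theorem hasMultiplicityAt_X_two_sub_X_zero {u v : k} (hv : v ≠ 1) :
    HasMultiplicityAt (X 2 - X 0) (affinePoint u v) 0 :=
  (hasMultiplicityAt_zero_iff isHomogeneous_X_two_sub_X_zero).mpr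
    (by simpa using sub_ne_zero.mpr hv)

theorem eval_connectingLine (i : ℕ) (u v : k) :
    eval ![1, u, v] (connectingLine k i) = u + i * (v - 2) := by
  simp [connectingLine]

theorem hasMultiplicityAt_connectingLine_one {i : ℕ} {u v : k} (h : u + i * (v - 2) = 0) :
    HasMultiplicityAt (connectingLine k i) (affinePoint u v) 1 := by
  refine hasMultiplicityAt_of_contraction_eq (q := Polynomial.C (connectingLine k i)) ?_
    (by simpa using connectingLine_ne_zero i)
  have h' : (C u + (i : MvPolynomial (Fin 3) k) * (C v - 2) : MvPolynomial (Fin 3) k) = 0 := by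
    rw [← map_natCast C, ← map_ofNat C 2, ← C_sub, ← C_mul, ← C_add, h, C_0]
  have h'' := congrArg (fun g => (1 - Polynomial.X) * Polynomial.C (g * X 0)) h'
  simp only [connectingLine, map_add, map_sub, map_mul, contraction_X_zero, contraction_X_one,
    contraction_X_two, map_ofNat (contraction u v) 2, map_natCast, map_zero, zero_mul, mul_zero,
    map_ofNat Polynomial.C 2] at h'' ⊢
  linear_combination h''

theorem hasMultiplicityAt_connectingLine_zero {i : ℕ} {u v : k} (h : u + i * (v - 2) ≠ 0) :
    HasMultiplicityAt (connectingLine k i) (affinePoint u v) 0 :=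
  (hasMultiplicityAt_zero_iff (isHomogeneous_connectingLine i)).mpr
    (by rwa [eval_connectingLine])

/-- A curve that meets a horizontal line transversally at a point is smooth at that point. -/
theorem hasMultiplicityAt_one_of_aeval_eq_prod {u c a : k} {n : ℕ} {g : MvPolynomial (Fin 3) k}
    (hg : g.IsHomogeneous n) (h0 : eval ![1, u, c] g = 0) {ι : Type*} (s : Finset ι) (t : ι → k)
    (ht : Set.InjOn t s) (ha : a ≠ 0)
    (hprod : aeval ![1, Polynomial.X, Polynomial.C c] g =
      Polynomial.C a * ∏ i ∈ s, (Polynomial.X - Polynomial.C (t i))) :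
    HasMultiplicityAt g (affinePoint u c) 1 := by
  refine ⟨?_, fun h2 => ?_⟩
  · rw [fatPointIdeal, pow_one]
    exact (mem_pointsIdeal_affinePoint_iff hg).mpr h0
  · have hdvd := pow_dvd_of_mem_fatPointIdeal
      (aeval (R := k) ![1, Polynomial.X, Polynomial.C c]).toRingHom
      (a := Polynomial.X - Polynomial.C u) (by simp) (by simp) h2
    change _ ∣ aeval ![1, Polynomial.X, Polynomial.C c] g at hdvd
    rw [hprod, (Polynomial.isUnit_C.mpr ha.isUnit).dvd_mul_left, pow_succ, pow_one] at hdvd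
    have hsep : (∏ i ∈ s, (Polynomial.X - Polynomial.C (t i))).Separable :=
      Polynomial.separable_prod_X_sub_C_iff'.mpr ht
    exact Polynomial.not_isUnit_X_sub_C u (hsep.squarefree _ hdvd)

theorem prod_two_mul_sub {ι : Type*} (s : Finset ι) (f : ι → Polynomial k) :
    ∏ i ∈ s, (2 * f i) = Polynomial.C (2 ^ s.card) * ∏ i ∈ s, f i := by
  rw [Finset.prod_mul_distrib, Finset.prod_const, Polynomial.C_pow, map_ofNat Polynomial.C 2]

/-- The form `L₁ ^ a₁ L₂ ^ a₂ M₁ ^ μ₁ ⋯ C ^ c` supported on the components of the extremal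
curve. -/
noncomputable def componentProduct (k : Type*) [Field k] (b a₁ a₂ : ℕ) (μ : ℕ → ℕ) (c : ℕ) :
    MvPolynomial (Fin 3) k :=
  X 2 ^ a₁ * (X 2 - X 0) ^ a₂ * (∏ i ∈ Finset.range b, connectingLine k i ^ μ i) *
    rationalCurve k b ^ c

theorem extremalForm_rationalCurve (b : ℕ) : extremalForm b (rationalCurve k b) =
    componentProduct k b (2 * b - 2) (2 * b - 3) (fun _ => 1) 1 := by
  simp [extremalForm, componentProduct, connectingLine]

theorem isHomogeneous_componentProduct (b a₁ a₂ : ℕ) (μ : ℕ → ℕ) (c : ℕ) :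
    (componentProduct k (b + 1) a₁ a₂ μ c).IsHomogeneous
      (a₁ + a₂ + ∑ i ∈ Finset.range (b + 1), μ i + (b + 1) * c) := by
  have h := ((((isHomogeneous_X k (2 : Fin 3)).pow a₁).mul
    (isHomogeneous_X_two_sub_X_zero.pow a₂)).mul
    (IsHomogeneous.prod (Finset.range (b + 1)) _ _
      fun i _ => (isHomogeneous_connectingLine (k := k) i).pow (μ i))).mul
    ((isHomogeneous_rationalCurve (k := k) b).pow c)
  simpa only [componentProduct, one_mul] using h

variable [CharZero k]

theorem hasMultiplicityAt_rationalCurve_odd (b : ℕ) {i : ℕ} (hi : i < b + 1) :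
    HasMultiplicityAt (rationalCurve k (b + 1)) (affinePoint (2 * (i : k) + 1) 0) 1 := by
  refine hasMultiplicityAt_one_of_aeval_eq_prod (isHomogeneous_rationalCurve b) ?_
    (a := 2 ^ (Finset.range (b + 1)).card) (Finset.range (b + 1)) (fun j => 2 * (j : k) + 1)
    (fun x _ y _ hxy => ?_) (pow_ne_zero _ two_ne_zero) ?_
  · rw [rationalCurve, map_add, map_mul, map_oddProd]
    simp only [eval_X, Matrix.cons_val, zero_mul, zero_add]
    refine oddProd_eq_zero i hi ?_
    simp
    ring
  · have hxy' : 2 * (x : k) + 1 = 2 * (y : k) + 1 := hxy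
    have : 2 * x + 1 = 2 * y + 1 := by exact_mod_cast hxy'
    omega
  · rw [← prod_two_mul_sub, rationalCurve, map_add, map_mul, map_oddProd, oddProd]
    simp only [aeval_X, Matrix.cons_val, map_sub, map_mul, map_zero, zero_mul, zero_add]
    refine Finset.prod_congr rfl fun j _ => ?_
    simp [map_ofNat Polynomial.C 2]
    ring

theorem hasMultiplicityAt_rationalCurve_one (b : ℕ) {i : ℕ} (hi : i < b + 1) :
    HasMultiplicityAt (rationalCurve k (b + 1)) (affinePoint (i : k) 1) 1 := by
  -- On the line `x₂ = x₀`, where `w = 1` and `z = -1`, the equation `w A + B` becomes `E`.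
  have key : ∀ {S : Type _} [CommRing S] (y : S),
      1 * prodDiffQuot (b + 1) y (-1) + oddProd (b + 1) y (-1) = evenProd (b + 1) y (-1) := by
    intro S _ y
    linear_combination -mul_prodDiffQuot (b + 1) y (-1)
  refine hasMultiplicityAt_one_of_aeval_eq_prod (isHomogeneous_rationalCurve b) ?_
    (a := 2 ^ (Finset.range (b + 1)).card) (Finset.range (b + 1)) (fun j => (j : k))
    (fun x _ y _ hxy => Nat.cast_injective (R := k) hxy) (pow_ne_zero _ two_ne_zero) ?_
  · rw [rationalCurve, map_add, map_mul, map_oddProd, map_prodDiffQuot]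
    simp only [eval_X, Matrix.cons_val, map_sub, map_mul]
    rw [show (1 : k) - eval ![1, (i : k), 1] 2 * 1 = -1 by simp; ring, key]
    refine evenProd_eq_zero i hi ?_
    ring
  · rw [← prod_two_mul_sub, rationalCurve, map_add, map_mul, map_oddProd, map_prodDiffQuot]
    simp only [aeval_X, Matrix.cons_val, map_sub, map_mul, Polynomial.C_1]
    rw [map_ofNat (aeval ![1, Polynomial.X, (1 : Polynomial k)]) 2,
      show (1 : Polynomial k) - 2 * 1 = -1 by ring, key, evenProd]
    refine Finset.prod_congr rfl fun j _ => ?_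
    simp
    ring

theorem hasMultiplicityAt_rationalCurve_even (b i : ℕ) :
    HasMultiplicityAt (rationalCurve k (b + 1)) (affinePoint (2 * (i : k)) 0) 0 := by
  refine (hasMultiplicityAt_zero_iff (isHomogeneous_rationalCurve b)).mpr ?_
  rw [rationalCurve, map_add, map_mul, map_oddProd]
  simp only [eval_X, Matrix.cons_val, zero_mul, zero_add]
  refine Finset.prod_ne_zero_iff.mpr fun j _ h => odd_ne_even_cast (k := k) j i ?_
  simp at h
  linear_combination (-1 / 2) * h

theorem hasMultiplicityAt_rationalCurve_vertex (b : ℕ) :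
    HasMultiplicityAt (rationalCurve k (b + 1)) (affinePoint 0 2) b := by
  set y : MvPolynomial (Fin 3) k := X 1 with hy
  set z : MvPolynomial (Fin 3) k := X 2 - 2 * X 0 with hz
  refine hasMultiplicityAt_of_contraction_eq
    (q := contraction 0 2 (X 2) * Polynomial.C (prodDiffQuot (b + 1) y z) +
      Polynomial.X * Polynomial.C (oddProd (b + 1) y z)) ?_ ?_
  · have hy' : contraction (0 : k) 2 y = Polynomial.X * Polynomial.C y := by simp [hy]
    have hz' : contraction (0 : k) 2 z = Polynomial.X * Polynomial.C z := by
      simp [hz, map_ofNat (contraction (0 : k) 2) 2, map_ofNat (C (σ := Fin 3) (R := k)) 2,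
        map_ofNat (Polynomial.C (R := MvPolynomial (Fin 3) k)) 2]
    rw [rationalCurve, ← hy, ← hz, map_add, map_mul, map_oddProd, map_prodDiffQuot, hy', hz',
      prodDiffQuot_succ_mul_mul, oddProd_mul_mul, map_oddProd, map_prodDiffQuot]
    ring
  · have hcoeff : (contraction (0 : k) 2 (X 2)).coeff 0 = C 2 * X 0 := by simp
    rw [Polynomial.coeff_add, Polynomial.coeff_mul_C, Polynomial.coeff_X_mul_zero, hcoeff, add_zero]
    exact mul_ne_zero (mul_ne_zero (by simp) (X_ne_zero _))
      (prodDiffQuot_succ_X_ne_zero b)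

theorem componentProduct_ne_zero (b a₁ a₂ : ℕ) (μ : ℕ → ℕ) (c : ℕ) :
    componentProduct k (b + 1) a₁ a₂ μ c ≠ 0 :=
  mul_ne_zero (mul_ne_zero (mul_ne_zero (pow_ne_zero _ (X_ne_zero _))
    (pow_ne_zero _ X_two_sub_X_zero_ne_zero))
    (Finset.prod_ne_zero_iff.mpr fun i _ => pow_ne_zero _ (connectingLine_ne_zero i)))
    (pow_ne_zero _ (irreducible_rationalCurve b).ne_zero)

theorem hasMultiplicityAt_componentProduct_even (b a₁ a₂ : ℕ) (μ : ℕ → ℕ) (c : ℕ) {i : ℕ}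
    (hi : i < b + 1) : HasMultiplicityAt (componentProduct k (b + 1) a₁ a₂ μ c)
      (affinePoint (2 * (i : k)) 0) (a₁ + μ i) := by
  have hM := HasMultiplicityAt.prod (Finset.range (b + 1)) (u := 2 * (i : k)) (v := 0)
    (g := fun j => connectingLine k j ^ μ j) (m := fun j => μ j * if j = i then 1 else 0)
    fun j _ => by
      refine HasMultiplicityAt.pow ?_ _
      split_ifs with hij
      · exact hasMultiplicityAt_connectingLine_one (by rw [hij]; ring)
      · refine hasMultiplicityAt_connectingLine_zero fun h => hij ?_
        have : (j : k) = i := by linear_combination (-1 / 2) * h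
        exact_mod_cast this
  have h := ((((hasMultiplicityAt_X_two_zero _).pow a₁).mul
    ((hasMultiplicityAt_X_two_sub_X_zero zero_ne_one).pow a₂)).mul hM).mul
    ((hasMultiplicityAt_rationalCurve_even b i).pow c)
  simpa [componentProduct, hi] using h

theorem hasMultiplicityAt_componentProduct_odd (b a₁ a₂ : ℕ) (μ : ℕ → ℕ) (c : ℕ) {i : ℕ}
    (hi : i < b + 1) : HasMultiplicityAt (componentProduct k (b + 1) a₁ a₂ μ c)
      (affinePoint (2 * (i : k) + 1) 0) (a₁ + c) := by
  have hM := HasMultiplicityAt.prod (Finset.range (b + 1)) (u := 2 * (i : k) + 1) (v := 0)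
    (g := fun j => connectingLine k j ^ μ j) (m := fun j => μ j * 0)
    fun j _ => by
      refine HasMultiplicityAt.pow ?_ _
      refine hasMultiplicityAt_connectingLine_zero fun h => odd_ne_even_cast (k := k) i j ?_
      linear_combination h
  have h := ((((hasMultiplicityAt_X_two_zero _).pow a₁).mul
    ((hasMultiplicityAt_X_two_sub_X_zero zero_ne_one).pow a₂)).mul hM).mul
    ((hasMultiplicityAt_rationalCurve_odd b hi).pow c)
  simpa [componentProduct] using h

theorem hasMultiplicityAt_componentProduct_one (b a₁ a₂ : ℕ) (μ : ℕ → ℕ) (c : ℕ) {i : ℕ}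
    (hi : i < b + 1) : HasMultiplicityAt (componentProduct k (b + 1) a₁ a₂ μ c)
      (affinePoint (i : k) 1) (a₂ + μ i + c) := by
  have hM := HasMultiplicityAt.prod (Finset.range (b + 1)) (u := (i : k)) (v := 1)
    (g := fun j => connectingLine k j ^ μ j) (m := fun j => μ j * if j = i then 1 else 0)
    fun j _ => by
      refine HasMultiplicityAt.pow ?_ _
      split_ifs with hij
      · exact hasMultiplicityAt_connectingLine_one (by rw [hij]; ring)
      · refine hasMultiplicityAt_connectingLine_zero fun h => hij ?_
        have : (j : k) = i := by linear_combination -h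
        exact_mod_cast this
  have h := ((((hasMultiplicityAt_X_two one_ne_zero).pow a₁).mul
    ((hasMultiplicityAt_X_two_sub_X_zero_one _).pow a₂)).mul hM).mul
    ((hasMultiplicityAt_rationalCurve_one b hi).pow c)
  simpa [componentProduct, hi] using h

theorem hasMultiplicityAt_componentProduct_vertex (b a₁ a₂ : ℕ) (μ : ℕ → ℕ) (c : ℕ) :
    HasMultiplicityAt (componentProduct k (b + 1) a₁ a₂ μ c) (affinePoint 0 2)
      (∑ i ∈ Finset.range (b + 1), μ i + c * b) := by
  have hM := HasMultiplicityAt.prod (Finset.range (b + 1)) (u := (0 : k)) (v := 2)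
    (g := fun j => connectingLine k j ^ μ j) (m := fun j => μ j * 1)
    fun j _ => (hasMultiplicityAt_connectingLine_one (by ring)).pow _
  have h21 : (2 : k) ≠ 1 := by norm_num
  have h := ((((hasMultiplicityAt_X_two two_ne_zero).pow a₁).mul
    ((hasMultiplicityAt_X_two_sub_X_zero h21).pow a₂)).mul hM).mul
    ((hasMultiplicityAt_rationalCurve_vertex b).pow c)
  simpa [componentProduct] using h

end Components

/-! ### Symbolic powers of the ideal of finitely many points -/

section SymbolicPower

variable {R : Type*} [CommRing R] {ι : Type*} [Finite ι] {I : ι → Ideal R}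

/-- Each of finitely many incomparable primes misses an element of all the others. -/
theorem exists_notMem_forall_ne_mem (hprime : ∀ i, (I i).IsPrime)
    (hle : ∀ i j, I i ≤ I j → i = j) (i : ι) : ∃ x, x ∉ I i ∧ ∀ j, j ≠ i → x ∈ I j := by
  classical
  have := Fintype.ofFinite ι
  by_contra! h
  have hinf : (Finset.univ.erase i).inf I ≤ I i := by
    intro x hx
    by_contra hxi
    obtain ⟨j, hji, hj⟩ := h x hxi
    exact hj (Finset.inf_le (f := I) (Finset.mem_erase.mpr ⟨hji, Finset.mem_univ j⟩) hx)
  obtain ⟨j, hj, hji⟩ := (hprime i).inf_le'.mp hinf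
  exact Finset.ne_of_mem_erase hj (hle j i hji)

theorem associatedPrimes_quotient_iInf [IsNoetherianRing R] (hprime : ∀ i, (I i).IsPrime)
    (hle : ∀ i j, I i ≤ I j → i = j) :
    associatedPrimes R (R ⧸ ⨅ i, I i) = Set.range I := by
  classical
  have := Fintype.ofFinite ι
  have hmem : ∀ r a : R, r ∈ (⊥ : Submodule R (R ⧸ ⨅ i, I i)).colon
      {Ideal.Quotient.mk (⨅ i, I i) a} ↔ ∀ i, r * a ∈ I i := by
    intro r a
    rw [Submodule.mem_colon_singleton, Submodule.mem_bot, ← Ideal.mem_iInf,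
      ← Ideal.Quotient.eq_zero_iff_mem, map_mul]
    rfl
  ext p
  rw [AssociatedPrimes.mem_iff, isAssociatedPrime_iff]
  constructor
  · rintro ⟨hp, x, hx⟩
    obtain ⟨a, rfl⟩ := Ideal.Quotient.mk_surjective x
    have hpa : ∀ r, r ∈ p ↔ ∀ i, r * a ∈ I i := fun r => by rw [hx, hmem]
    have hinf : (Finset.univ.filter fun i => a ∉ I i).inf I ≤ p := by
      intro r hr
      rw [hpa]
      intro i
      by_cases hai : a ∈ I i
      · exact Ideal.mul_mem_left _ _ hai
      · exact Ideal.mul_mem_right _ _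
          (Finset.inf_le (f := I) (Finset.mem_filter.mpr ⟨Finset.mem_univ i, hai⟩) hr)
    obtain ⟨i, hi, hip⟩ := hp.inf_le'.mp hinf
    refine ⟨i, le_antisymm hip fun r hr => ?_⟩
    exact ((hprime i).mem_or_mem ((hpa r).mp hr i)).resolve_right (Finset.mem_filter.mp hi).2
  · rintro ⟨i, rfl⟩
    obtain ⟨a, hai, haj⟩ := exists_notMem_forall_ne_mem hprime hle i
    refine ⟨hprime i, Ideal.Quotient.mk _ a, Ideal.ext fun r => ?_⟩
    rw [hmem]
    constructor
    · intro hr j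
      by_cases hj : j = i
      · exact hj ▸ Ideal.mul_mem_right _ _ hr
      · exact Ideal.mul_mem_left _ _ (haj j hj)
    · exact fun h => ((hprime i).mem_or_mem (h i)).resolve_right hai

/-- For incomparable primes with primary powers, the symbolic powers of the intersection are the
intersections of the powers. -/
theorem symbolicPower_iInf [IsNoetherianRing R] (hprime : ∀ i, (I i).IsPrime)
    (hle : ∀ i j, I i ≤ I j → i = j) (t : ℕ)
    (hprimary : ∀ i x y, x ∉ I i → x * y ∈ I i ^ t → y ∈ I i ^ t) :
    symbolicPower (⨅ i, I i) t = ⨅ i, I i ^ t := by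
  have hloc : ∀ P : associatedPrimes R (R ⧸ ⨅ i, I i), ∀ i, I i = P.1 → ∀ g : R,
      g ∈ (((⨅ i, I i) ^ t).map (algebraMap R (Localization.AtPrime P.1))).comap
        (algebraMap R (Localization.AtPrime P.1)) ↔ g ∈ I i ^ t := by
    intro P i hi g
    rw [Ideal.mem_comap,
      IsLocalization.algebraMap_mem_map_algebraMap_iff P.1.primeCompl (Localization.AtPrime P.1)]
    constructor
    · rintro ⟨x, hx, hxg⟩
      exact hprimary i x g (hi ▸ hx) (Ideal.pow_right_mono (iInf_le I i) t hxg)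
    · intro hg
      obtain ⟨a, hai, haj⟩ := exists_notMem_forall_ne_mem hprime hle i
      refine ⟨a ^ t, ?_, ?_⟩
      · change a ^ t ∉ P.1
        rw [← hi]
        exact fun h => hai ((hprime i).mem_of_pow_mem t h)
      · have hsub : Ideal.span {a} * I i ≤ ⨅ j, I j := by
          rw [Ideal.span_singleton_mul_le_iff]
          intro r hr
          rw [Ideal.mem_iInf]
          intro j
          by_cases hj : j = i
          · exact hj ▸ Ideal.mul_mem_left _ _ hr
          · exact Ideal.mul_mem_right _ _ (haj j hj)
        refine Ideal.pow_right_mono hsub t ?_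
        rw [mul_pow, Ideal.span_singleton_pow]
        exact Ideal.mul_mem_mul (Ideal.mem_span_singleton_self _) hg
  have hass := associatedPrimes_quotient_iInf hprime hle
  ext g
  rw [symbolicPower, Ideal.mem_iInf, Ideal.mem_iInf]
  constructor
  · intro h i
    have hi : I i ∈ associatedPrimes R (R ⧸ ⨅ i, I i) := hass ▸ Set.mem_range_self i
    exact (hloc ⟨I i, hi⟩ i rfl g).mp (h ⟨I i, hi⟩)
  · intro h P
    obtain ⟨i, hi⟩ : P.1 ∈ Set.range I := hass ▸ P.2
    exact (hloc P i hi g).mpr (h i)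

end SymbolicPower

section Points

variable {k : Type*} [Field k]

theorem isPrime_pointsIdeal_affinePoint (u v : k) :
    (pointsIdeal {affinePoint u v}).IsPrime := by
  have hmem : ∀ g, g ∈ pointsIdeal {affinePoint u v} ↔ Polynomial.X ∣ contraction u v g := by
    intro g
    have := mem_fatPointIdeal_iff u v 1 g
    rwa [fatPointIdeal, pow_one, pow_one] at this
  refine ⟨fun h => ?_, fun {x y} hxy => ?_⟩
  · have := (hmem 1).mp (h ▸ Submodule.mem_top)
    rw [map_one] at this
    exact Polynomial.prime_X.not_dvd_one this
  · rw [hmem, map_mul] at hxy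
    rw [hmem, hmem]
    exact Polynomial.prime_X.dvd_or_dvd hxy

theorem eq_of_pointsIdeal_affinePoint_le {u v u' v' : k}
    (h : pointsIdeal {affinePoint u v} ≤ pointsIdeal {affinePoint u' v'}) : u = u' ∧ v = v' := by
  have key : ∀ (i : Fin 3) (a : k), eval ![1, u, v] (X i - C a * X 0) = 0 →
      eval ![1, u', v'] (X i - C a * X 0) = 0 := fun i a h0 =>
    (mem_pointsIdeal_affinePoint_iff (isHomogeneous_X_sub_C_mul_X i 0 a)).mp
      (h ((mem_pointsIdeal_affinePoint_iff (isHomogeneous_X_sub_C_mul_X i 0 a)).mpr h0))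
  have h1 := key 1 u (by simp)
  have h2 := key 2 v (by simp)
  simp only [map_sub, map_mul, eval_X, eval_C, Matrix.cons_val] at h1 h2
  constructor
  · linear_combination -h1
  · linear_combination -h2

theorem pointsIdeal_eq_iInf (X : Set (ProjPlane k)) :
    pointsIdeal X = ⨅ P : X, pointsIdeal {P.1} := by
  let := gradedAlgebra (σ := Fin 3) (R := k)
  have hhom : ∀ Y : Set (ProjPlane k),
      (pointsIdeal Y).IsHomogeneous (homogeneousSubmodule (Fin 3) k) := fun Y =>
    Ideal.homogeneous_span _ _ fun g hg => hg.1
  apply le_antisymm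
  · refine le_iInf fun P => Ideal.span_mono ?_
    rintro g ⟨hn, hg⟩
    refine ⟨hn, ?_⟩
    rintro Q rfl
    exact hg _ P.2
  · intro g hg
    rw [mem_iff_homogeneousComponent_mem (hhom X)]
    intro n
    refine Ideal.subset_span ⟨⟨n, homogeneousComponent_isHomogeneous n g⟩, fun P hP => ?_⟩
    have hgP := homogeneousComponent_mem_of_mem (hhom {P}) (Ideal.mem_iInf.mp hg ⟨P, hP⟩) n
    -- The forms that generate the ideal of `P` vanish at the representative of `P`.
    have hker : pointsIdeal {P} ≤ RingHom.ker (eval P.rep) :=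
      Ideal.span_le.mpr fun f hf => hf.2 P rfl
    exact hker hgP

theorem symbolicPower_pointsIdeal {X : Set (ProjPlane k)} (hfin : X.Finite)
    (haff : ∀ P ∈ X, ∃ u v, P = affinePoint u v) (t : ℕ) :
    symbolicPower (pointsIdeal X) t = fatPointsIdeal X t := by
  have : Finite X := hfin
  rw [pointsIdeal_eq_iInf, symbolicPower_iInf, fatPointsIdeal, iInf_subtype']
  · rfl
  · rintro ⟨P, hP⟩
    obtain ⟨u, v, rfl⟩ := haff P hP
    exact isPrime_pointsIdeal_affinePoint u v
  · rintro ⟨P, hP⟩ ⟨Q, hQ⟩ hPQ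
    obtain ⟨u, v, rfl⟩ := haff P hP
    obtain ⟨u', v', rfl⟩ := haff Q hQ
    obtain ⟨rfl, rfl⟩ := eq_of_pointsIdeal_affinePoint_le hPQ
    rfl
  · rintro ⟨P, hP⟩ x y hx hxy
    obtain ⟨u, v, rfl⟩ := haff P hP
    have h0 : HasMultiplicityAt x (affinePoint u v) 0 :=
      ⟨by simp [fatPointIdeal], by rwa [fatPointIdeal, zero_add, pow_one]⟩
    exact h0.mem_of_mul_mem hxy

end Points

/-! ### The degree bound -/

section DegreeBound

variable {k : Type*} [Field k]

theorem exists_eq_prod_pow_mul_and_not_dvd {σ ι : Type*} (s : Finset ι) (g : ι → MvPolynomial σ k)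
    (hg : ∀ i ∈ s, ¬ IsUnit (g i)) {h : MvPolynomial σ k} (h0 : h ≠ 0) :
    ∃ (μ : ι → ℕ) (h' : MvPolynomial σ k),
      h = (∏ i ∈ s, g i ^ μ i) * h' ∧ ∀ i ∈ s, ¬ g i ∣ h' := by
  classical
  induction s using Finset.induction_on generalizing h with
  | empty => exact ⟨fun _ => 0, h, by simp, by simp⟩
  | insert a s ha ih =>
    obtain ⟨h₁, h₁eq, h₁dvd⟩ := (FiniteMultiplicity.of_not_isUnit
      (hg a (Finset.mem_insert_self a s)) h0).exists_eq_pow_mul_and_not_dvd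
    have h₁0 : h₁ ≠ 0 := by
      rintro rfl
      exact h₁dvd (dvd_zero _)
    obtain ⟨μ, h', h'eq, h'dvd⟩ := ih (fun i hi => hg i (Finset.mem_insert_of_mem hi)) h₁0
    refine ⟨Function.update μ a (multiplicity (g a) h), h', ?_, fun i hi => ?_⟩
    · have hs : ∏ i ∈ s, g i ^ Function.update μ a (multiplicity (g a) h) i =
          ∏ i ∈ s, g i ^ μ i := Finset.prod_congr rfl fun i hi => by
        rw [Function.update_of_ne (ne_of_mem_of_not_mem hi ha)]
      rw [Finset.prod_insert ha, Function.update_self, hs, mul_assoc, ← h'eq]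
      exact h₁eq
    · rcases Finset.mem_insert.mp hi with rfl | hi
      · exact fun hd => h₁dvd (h'eq ▸ hd.mul_left _)
      · exact h'dvd i hi

theorem not_isUnit_of_eval_eq_zero {σ : Type*} {g : MvPolynomial σ k} (x : σ → k)
    (h : eval x g = 0) : ¬ IsUnit g := fun hu => (hu.map (eval x)).ne_zero h

variable [CharZero k]

theorem exists_eq_componentProduct_mul (b : ℕ) {h : MvPolynomial (Fin 3) k} (h0 : h ≠ 0) :
    ∃ (a₁ a₂ : ℕ) (μ : ℕ → ℕ) (c : ℕ) (h' : MvPolynomial (Fin 3) k),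
      h = componentProduct k (b + 1) a₁ a₂ μ c * h' ∧ ¬ X 2 ∣ h' ∧ ¬ (X 2 - X 0) ∣ h' ∧
      (∀ i < b + 1, ¬ connectingLine k i ∣ h') ∧ ¬ rationalCurve k (b + 1) ∣ h' := by
  obtain ⟨μ, h₁, h₁eq, h₁dvd⟩ := exists_eq_prod_pow_mul_and_not_dvd (Finset.range (b + 1))
    (connectingLine k) (fun i _ => not_isUnit_of_eval_eq_zero ![1, 0, 2]
      (by rw [eval_connectingLine]; ring)) h0
  have h₁0 : h₁ ≠ 0 := by
    rintro rfl
    exact h0 (by rw [h₁eq, mul_zero])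
  obtain ⟨ν, h', h'eq, h'dvd⟩ := exists_eq_prod_pow_mul_and_not_dvd Finset.univ
    ![X 2, X 2 - X 0, rationalCurve k (b + 1)] (fun i _ => by
      fin_cases i
      · exact not_isUnit_of_eval_eq_zero 0 (by simp)
      · exact not_isUnit_of_eval_eq_zero 0 (by simp)
      · exact (irreducible_rationalCurve b).not_isUnit) h₁0
  refine ⟨ν 0, ν 1, μ, ν 2, h', ?_, h'dvd 0 (Finset.mem_univ _), h'dvd 1 (Finset.mem_univ _),
    fun i hi hd => ?_, h'dvd 2 (Finset.mem_univ _)⟩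
  · rw [h₁eq, h'eq, componentProduct, Fin.prod_univ_three]
    simp only [Matrix.cons_val]
    ring
  · exact h₁dvd i (Finset.mem_range.mpr hi) (h'eq ▸ hd.mul_left _)

/-- The curve of degree `d` has multiplicity at least `T` at the points of the standard
configuration of type `(1, b, 2 b)`. -/
structure HasMultiplicitiesGE (b : ℕ) (h : MvPolynomial (Fin 3) k) (T : ℕ) : Prop where
  even : ∀ i < b, h ∈ fatPointIdeal (affinePoint (2 * (i : k)) 0) T
  odd : ∀ i < b, h ∈ fatPointIdeal (affinePoint (2 * (i : k) + 1) 0) T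
  one : ∀ i < b, h ∈ fatPointIdeal (affinePoint (i : k) 1) T
  vertex : h ∈ fatPointIdeal (affinePoint 0 2) T

/-- Every curve with multiplicity at least `T` at the points of the configuration has degree at
least `(6 b - 5) T / (2 b - 1)`, here with `b + 1` in place of `b`. After the components of the
extremal curve have been removed, Bézout's inequality holds for the remaining curve and each of
these components; the bound is a positive combination of these inequalities in which the
multiplicities of the removed components cancel. -/
theorem le_degree_of_hasMultiplicitiesGE {b : ℕ} (hb : 1 ≤ b) {T d : ℕ}
    {h : MvPolynomial (Fin 3) k} (h0 : h ≠ 0) (hh : h.IsHomogeneous d)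
    (hT : HasMultiplicitiesGE (b + 1) h T) : (6 * b + 1) * T ≤ (2 * b + 1) * d := by
  obtain ⟨a₁, a₂, μ, c, h', rfl, hL₁, hL₂, hM, hC⟩ := exists_eq_componentProduct_mul b h0
  obtain ⟨δ, hδ, hh'⟩ := (isHomogeneous_componentProduct b a₁ a₂ μ c).of_mul_left h0 hh
  have heven : ∀ i < b + 1, h' ∈ fatPointIdeal (affinePoint (2 * (i : k)) 0) (T - (a₁ + μ i)) :=
    fun i hi => (hasMultiplicityAt_componentProduct_even b a₁ a₂ μ c hi).mem_of_mul_mem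
      (hT.even i hi)
  have hodd : ∀ i < b + 1, h' ∈ fatPointIdeal (affinePoint (2 * (i : k) + 1) 0) (T - (a₁ + c)) :=
    fun i hi => (hasMultiplicityAt_componentProduct_odd b a₁ a₂ μ c hi).mem_of_mul_mem
      (hT.odd i hi)
  have hone : ∀ i < b + 1, h' ∈ fatPointIdeal (affinePoint (i : k) 1) (T - (a₂ + μ i + c)) :=
    fun i hi => (hasMultiplicityAt_componentProduct_one b a₁ a₂ μ c hi).mem_of_mul_mem
      (hT.one i hi)
  have hvertex := (hasMultiplicityAt_componentProduct_vertex b a₁ a₂ μ c).mem_of_mul_mem hT.vertex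
  set M := ∑ i ∈ Finset.range (b + 1), μ i with hMdef
  -- Bézout for `x₂ = 0`
  have e₁ : ∑ i ∈ Finset.range (b + 1), (T - (a₁ + μ i)) +
      ∑ _i ∈ Finset.range (b + 1), (T - (a₁ + c)) ≤ δ := by
    have := sum_le_of_not_lineForm_dvd (u₀ := (0 : k)) (v₀ := 0) (u₁ := 1) (v₁ := 0)
      (Or.inl one_ne_zero) hh' (by simpa [lineForm] using hL₁)
      ((Finset.range (b + 1)).disjSum (Finset.range (b + 1)))
      (Sum.elim (fun i => 2 * (i : k)) (fun i => 2 * (i : k) + 1))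
      (by
        rintro (x | x) _ (y | y) _ hxy
        · have hxy' : 2 * (x : k) = 2 * (y : k) := hxy
          have : 2 * x = 2 * y := by exact_mod_cast hxy'
          exact congrArg _ (by omega)
        · exact absurd hxy.symm (odd_ne_even_cast y x)
        · exact absurd hxy (odd_ne_even_cast x y)
        · have hxy' : 2 * (x : k) + 1 = 2 * (y : k) + 1 := hxy
          have : 2 * x + 1 = 2 * y + 1 := by exact_mod_cast hxy'
          exact congrArg _ (by omega))
      (Sum.elim (fun i => T - (a₁ + μ i)) (fun _ => T - (a₁ + c)))
      (by
        rintro (i | i) hi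
        · have := heven i (by simpa using hi)
          simpa using this
        · have := hodd i (by simpa using hi)
          simpa using this)
    simpa only [Finset.sum_disjSum, Sum.elim_inl, Sum.elim_inr] using this
  -- Bézout for `x₂ = x₀`
  have e₂ : ∑ i ∈ Finset.range (b + 1), (T - (a₂ + μ i + c)) ≤ δ :=
    sum_le_of_not_lineForm_dvd (u₀ := (0 : k)) (v₀ := 1) (u₁ := 1) (v₁ := 0)
      (Or.inl one_ne_zero) hh' (by simpa [lineForm] using hL₂) (Finset.range (b + 1))
      (fun i => (i : k)) (fun x _ y _ hxy => Nat.cast_injective (R := k) hxy) _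
      (fun i hi => by simpa using hone i (Finset.mem_range.mp hi))
  -- Bézout for the connecting lines, which carry three points each
  have e₃ : ∀ i ∈ Finset.range (b + 1),
      (T - (a₁ + μ i)) + (T - (a₂ + μ i + c)) + (T - (M + c * b)) ≤ δ := by
    intro i hi
    have hi' := Finset.mem_range.mp hi
    have := sum_le_of_not_lineForm_dvd (u₀ := (0 : k)) (v₀ := 2) (u₁ := i) (v₁ := -1)
      (Or.inr (neg_ne_zero.mpr one_ne_zero)) hh' (by
        have : lineForm (0 : k) 2 i (-1) = connectingLine k i := by
          simp [lineForm, connectingLine, map_ofNat (C (σ := Fin 3) (R := k)) 2]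
          ring
        rw [this]
        exact hM i hi') Finset.univ ![2, 1, 0]
      (by
        intro x _ y _ hxy
        fin_cases x <;> fin_cases y <;> first | rfl | (exfalso; norm_num at hxy))
      ![T - (a₁ + μ i), T - (a₂ + μ i + c), T - (M + c * b)]
      (by
        intro j _
        fin_cases j
        · have := heven i hi'
          simpa [mul_comm] using this
        · have h21 : (2 : k) + -1 = 1 := by norm_num
          simpa [h21] using hone i hi'
        · simpa using hvertex)
    simpa [Fin.sum_univ_three] using this
  -- Bézout for the rational curve
  have e₄ := sum_add_sum_add_le_of_not_rationalCurve_dvd b hh' hC (fun _ => T - (a₁ + c))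
    (fun i => T - (a₂ + μ i + c)) _ hodd hone hvertex
  have e₃' := Finset.sum_le_sum e₃
  -- The same inequalities over the integers, without truncation.
  have hsub : ∀ x : ℕ, (T : ℤ) - x ≤ ((T - x : ℕ) : ℤ) := fun x => by omega
  have hμ : ((M : ℕ) : ℤ) = ∑ i ∈ Finset.range (b + 1), (μ i : ℤ) := by
    rw [hMdef, Nat.cast_sum]
  have s₁ : ((b : ℤ) + 1) * (T - a₁) - M ≤
      ((∑ i ∈ Finset.range (b + 1), (T - (a₁ + μ i)) : ℕ) : ℤ) := by
    rw [Nat.cast_sum _ fun i => T - (a₁ + μ i)]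
    refine le_trans (le_of_eq ?_) (Finset.sum_le_sum fun i _ => hsub (a₁ + μ i))
    simp only [Nat.cast_add, Finset.sum_sub_distrib, Finset.sum_add_distrib, Finset.sum_const,
      Finset.card_range, hμ, nsmul_eq_mul, Nat.cast_one]
    ring
  have s₂ : ((b : ℤ) + 1) * (T - a₂ - c) - M ≤
      ((∑ i ∈ Finset.range (b + 1), (T - (a₂ + μ i + c)) : ℕ) : ℤ) := by
    rw [Nat.cast_sum _ fun i => T - (a₂ + μ i + c)]
    refine le_trans (le_of_eq ?_) (Finset.sum_le_sum fun i _ => hsub (a₂ + μ i + c))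
    simp only [Nat.cast_add, Finset.sum_sub_distrib, Finset.sum_add_distrib, Finset.sum_const,
      Finset.card_range, hμ, nsmul_eq_mul, Nat.cast_one]
    ring
  have so := hsub (a₁ + c)
  have sv := hsub (M + c * b)
  simp only [Finset.sum_add_distrib, Finset.sum_const, Finset.card_range, smul_eq_mul]
    at e₁ e₂ e₃' e₄
  zify at e₁ e₂ e₃' e₄ hδ hb
  push_cast at e₁ e₂ e₃' e₄ hδ s₁ s₂ so sv
  have hb0 : (0 : ℤ) ≤ b := by positivity
  have so' := mul_le_mul_of_nonneg_left so (by positivity : (0 : ℤ) ≤ b + 1)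
  have sv' := mul_le_mul_of_nonneg_left sv (by positivity : (0 : ℤ) ≤ b + 1)
  have sv'' := mul_le_mul_of_nonneg_left sv hb0
  have f₁ : ((b : ℤ) + 1) * (T - a₁) - M + (b + 1) * (T - (a₁ + c)) ≤ δ := by linarith
  have f₂ : ((b : ℤ) + 1) * (T - a₂ - c) - M ≤ δ := by linarith
  have f₃ : ((b : ℤ) + 1) * (T - a₁) - M + (((b : ℤ) + 1) * (T - a₂ - c) - M) +
      (b + 1) * (T - (M + c * b)) ≤ (b + 1) * δ := by linarith
  have f₄ : ((b : ℤ) + 1) * (T - (a₁ + c)) + (((b : ℤ) + 1) * (T - a₂ - c) - M) +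
      b * (T - (M + c * b)) ≤ δ * (b + 1) := by linarith
  have hδ0 : (0 : ℤ) ≤ δ := by positivity
  have hpos : (0 : ℤ) ≤ 2 * b - 1 := by linarith
  have g₃ := mul_le_mul_of_nonneg_left f₃ hpos
  have g₄ := mul_le_mul_of_nonneg_left f₄ (mul_nonneg (by linarith : (0 : ℤ) ≤ 2 * (b + 1)) hpos)
  have g₀ := mul_nonneg (mul_nonneg zero_le_two hpos) hδ0
  -- The weights `2`, `4`, `2 b - 1`, `2 (b + 1) (2 b - 1)` and `2 (2 b - 1)` of `f₁`, `f₂`, `f₃`,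
  -- `f₄` and `0 ≤ δ` are those for which `a₁`, `a₂`, `M` and `c` cancel.
  have hfinal : ((b : ℤ) + 1) * (2 * b + 1) * ((6 * b + 1) * T) ≤
      (b + 1) * (2 * b + 1) * ((2 * b + 1) * d) := by
    rw [← hδ]
    linarith
  have := le_of_mul_le_mul_left hfinal (by positivity)
  exact_mod_cast this

/-- Here too `b + 1` stands for `b`. A curve of degree `d ≤ m (6 b - 5)` with multiplicities at
least `m (2 b - 1)` that does not contain the rational curve would meet it at the points of the
configuration at least `m (2 b - 1) (3 b - 1) = m (6 b - 5) b + m` times, more than Bézout's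
inequality allows. -/
theorem rationalCurve_dvd_of_hasMultiplicitiesGE (b : ℕ) {m d : ℕ} (hm : 0 < m)
    (hd : d ≤ m * (6 * b + 1)) {h : MvPolynomial (Fin 3) k} (hh : h.IsHomogeneous d)
    (hT : HasMultiplicitiesGE (b + 1) h (m * (2 * b + 1))) : rationalCurve k (b + 1) ∣ h := by
  by_contra hC
  have e := sum_add_sum_add_le_of_not_rationalCurve_dvd b hh hC (fun _ => m * (2 * b + 1))
    (fun _ => m * (2 * b + 1)) _ hT.odd hT.one hT.vertex
  simp only [Finset.sum_const, Finset.card_range, smul_eq_mul] at e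
  have := Nat.mul_le_mul_right (b + 1) hd
  nlinarith

end DegreeBound

/-! ### Initial degrees and the Waldschmidt constant -/

section InitialDegree

variable {k σ : Type*} [Field k]

theorem initialDegree_le {I : Ideal (MvPolynomial σ k)} {d : ℕ} {g : MvPolynomial σ k}
    (hg : g ∈ I) (h0 : g ≠ 0) (hd : g.IsHomogeneous d) : initialDegree I ≤ d :=
  Nat.sInf_le ⟨g, hg, h0, hd⟩

theorem exists_isHomogeneous_initialDegree {I : Ideal (MvPolynomial σ k)} {d : ℕ}
    {g : MvPolynomial σ k} (hg : g ∈ I) (h0 : g ≠ 0) (hd : g.IsHomogeneous d) :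
    ∃ f ∈ I, f ≠ 0 ∧ f.IsHomogeneous (initialDegree I) :=
  Nat.sInf_mem (s := {d : ℕ | ∃ f ∈ I, f ≠ 0 ∧ f.IsHomogeneous d}) ⟨d, g, hg, h0, hd⟩

/-- A sequence at bounded distance from `t ↦ c t` grows at the rate `c`. -/
theorem tendsto_div_of_bounds {α : ℕ → ℕ} {N K : ℕ} (hN : 0 < N)
    (hlow : ∀ t, K * t ≤ N * α t) (hup : ∀ t, α t ≤ (t / N + 1) * K) :
    Tendsto (fun t : ℕ => (α t : ℝ) / t) atTop (𝓝 ((K : ℝ) / N)) := by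
  have hN' : (0 : ℝ) < N := by exact_mod_cast hN
  have hlim : Tendsto (fun t : ℕ => (K : ℝ) / N + K / t) atTop (𝓝 ((K : ℝ) / N)) := by
    simpa using tendsto_const_nhds.add (tendsto_const_div_atTop_nhds_zero_nat (K : ℝ))
  refine tendsto_of_tendsto_of_tendsto_of_le_of_le' tendsto_const_nhds hlim ?_ ?_
  · filter_upwards [eventually_gt_atTop 0] with t ht
    have ht' : (0 : ℝ) < t := by exact_mod_cast ht
    rw [div_le_div_iff₀ hN' ht', mul_comm (α t : ℝ)]
    exact_mod_cast hlow t
  · filter_upwards [eventually_gt_atTop 0] with t ht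
    have ht' : (0 : ℝ) < t := by exact_mod_cast ht
    have h1 : (α t : ℝ) ≤ (t / N + 1) * K := by
      have h2 : (α t : ℝ) ≤ ((t / N : ℕ) + 1) * K := by exact_mod_cast hup t
      exact h2.trans (by gcongr; exact Nat.cast_div_le)
    rw [div_le_iff₀ ht']
    refine h1.trans (le_of_eq ?_)
    field_simp

end InitialDegree

section Configuration

variable {k : Type*} [Field k]

theorem IsStandardKConfiguration.finite {s : ℕ} {d : Fin s → ℕ} {X : Set (ProjPlane k)}
    (hX : IsStandardKConfiguration d X) : X.Finite := by
  have : X = ⋃ i : Fin s, (fun j : ℕ => affinePoint (j : k) ((s - 1 - (i : ℕ) : ℕ) : k)) ''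
      Set.Iio (d i) := by
    rw [hX.eq_points]
    ext P
    simp [eq_comm]
  rw [this]
  exact Set.finite_iUnion fun i => (Set.finite_Iio _).image _

theorem IsStandardKConfiguration.forall_mem_iff {b : ℕ} {X : Set (ProjPlane k)}
    (hX : IsStandardKConfiguration ![1, b, 2 * b] X) (p : ProjPlane k → Prop) :
    (∀ P ∈ X, p P) ↔ (∀ i < b, p (affinePoint (2 * (i : k)) 0)) ∧
      (∀ i < b, p (affinePoint (2 * (i : k) + 1) 0)) ∧
      (∀ i < b, p (affinePoint (i : k) 1)) ∧ p (affinePoint 0 2) := by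
  rw [hX.eq_points]
  constructor
  · intro h
    refine ⟨fun i hi => h _ ⟨2, 2 * i, ?_, ?_⟩, fun i hi => h _ ⟨2, 2 * i + 1, ?_, ?_⟩,
      fun i hi => h _ ⟨1, i, ?_, ?_⟩, h _ ⟨0, 0, ?_, ?_⟩⟩
    all_goals first | (simp; done) | (simp; omega)
  · rintro ⟨he, ho, h1, hv⟩ P ⟨i, j, hj, rfl⟩
    fin_cases i
    · have : j = 0 := by simpa using hj
      subst this
      simpa using hv
    · simpa using h1 j (by simpa using hj)
    · have hj' : j < 2 * b := by simpa using hj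
      rcases Nat.even_or_odd' j with ⟨i, rfl | rfl⟩
      · simpa using he i (by omega)
      · simpa using ho i (by omega)

theorem IsStandardKConfiguration.mem_fatPointsIdeal_iff {b : ℕ} {X : Set (ProjPlane k)}
    (hX : IsStandardKConfiguration ![1, b, 2 * b] X) (T : ℕ) (h : MvPolynomial (Fin 3) k) :
    h ∈ fatPointsIdeal X T ↔ HasMultiplicitiesGE b h T := by
  rw [fatPointsIdeal]
  simp only [Ideal.mem_iInf]
  rw [hX.forall_mem_iff]
  exact ⟨fun ⟨h1, h2, h3, h4⟩ => ⟨h1, h2, h3, h4⟩, fun ⟨h1, h2, h3, h4⟩ => ⟨h1, h2, h3, h4⟩⟩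

theorem IsStandardKConfiguration.symbolicPower_eq {b : ℕ} {X : Set (ProjPlane k)}
    (hX : IsStandardKConfiguration ![1, b, 2 * b] X) (t : ℕ) :
    symbolicPower (pointsIdeal X) t = fatPointsIdeal X t :=
  symbolicPower_pointsIdeal hX.finite ((hX.forall_mem_iff _).mpr
    ⟨fun _ _ => ⟨_, _, rfl⟩, fun _ _ => ⟨_, _, rfl⟩, fun _ _ => ⟨_, _, rfl⟩, _, _, rfl⟩) t

theorem isHomogeneous_extremalForm {b : ℕ} (hb : 1 ≤ b) :
    (extremalForm (b + 1) (rationalCurve k (b + 1))).IsHomogeneous (6 * b + 1) := by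
  rw [extremalForm_rationalCurve]
  convert isHomogeneous_componentProduct (k := k) b _ _ _ _ using 1
  simp
  omega

variable [CharZero k]

theorem extremalForm_ne_zero (b : ℕ) :
    extremalForm (b + 1) (rationalCurve k (b + 1)) ≠ 0 := by
  rw [extremalForm_rationalCurve]
  exact componentProduct_ne_zero _ _ _ _ _

theorem IsStandardKConfiguration.hasMultiplicityAt_extremalForm {b : ℕ} (hb : 1 ≤ b)
    {X : Set (ProjPlane k)} (hX : IsStandardKConfiguration ![1, b + 1, 2 * (b + 1)] X) :
    ∀ P ∈ X, HasMultiplicityAt (extremalForm (b + 1) (rationalCurve k (b + 1))) P (2 * b + 1) := by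
  rw [extremalForm_rationalCurve, hX.forall_mem_iff]
  refine ⟨fun i hi => ?_, fun i hi => ?_, fun i hi => ?_, ?_⟩
  · have h := hasMultiplicityAt_componentProduct_even (k := k) b
      (2 * (b + 1) - 2) (2 * (b + 1) - 3) (fun _ => 1) 1 hi
    convert h using 1
    omega
  · have h := hasMultiplicityAt_componentProduct_odd (k := k) b
      (2 * (b + 1) - 2) (2 * (b + 1) - 3) (fun _ => 1) 1 hi
    convert h using 1
    omega
  · have h := hasMultiplicityAt_componentProduct_one (k := k) b
      (2 * (b + 1) - 2) (2 * (b + 1) - 3) (fun _ => 1) 1 hi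
    convert h using 1
    omega
  · have h := hasMultiplicityAt_componentProduct_vertex (k := k) b
      (2 * (b + 1) - 2) (2 * (b + 1) - 3) (fun _ => 1) 1
    convert h using 1
    simp
    omega

theorem IsStandardKConfiguration.extremalForm_pow_mem {b : ℕ} (hb : 1 ≤ b)
    {X : Set (ProjPlane k)} (hX : IsStandardKConfiguration ![1, b + 1, 2 * (b + 1)] X) {m t : ℕ}
    (ht : t ≤ m * (2 * b + 1)) :
    extremalForm (b + 1) (rationalCurve k (b + 1)) ^ m ∈ symbolicPower (pointsIdeal X) t := by
  rw [hX.symbolicPower_eq, fatPointsIdeal]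
  simp only [Ideal.mem_iInf]
  intro P hP
  refine Ideal.pow_le_pow_right (ht.trans (mul_comm m _).le) ?_
  rw [pow_mul]
  exact Ideal.pow_mem_pow (hX.hasMultiplicityAt_extremalForm hb P hP).1 m

theorem IsStandardKConfiguration.initialDegree_le {b : ℕ} (hb : 1 ≤ b)
    {X : Set (ProjPlane k)} (hX : IsStandardKConfiguration ![1, b + 1, 2 * (b + 1)] X) {m t : ℕ}
    (ht : t ≤ m * (2 * b + 1)) :
    initialDegree (symbolicPower (pointsIdeal X) t) ≤ m * (6 * b + 1) :=
  _root_.initialDegree_le (hX.extremalForm_pow_mem hb ht)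
    (pow_ne_zero m (extremalForm_ne_zero b))
    (by rw [mul_comm]; exact (isHomogeneous_extremalForm hb).pow m)

theorem IsStandardKConfiguration.le_initialDegree {b : ℕ} (hb : 1 ≤ b)
    {X : Set (ProjPlane k)} (hX : IsStandardKConfiguration ![1, b + 1, 2 * (b + 1)] X) (t : ℕ) :
    (6 * b + 1) * t ≤ (2 * b + 1) * initialDegree (symbolicPower (pointsIdeal X) t) := by
  obtain ⟨f, hf, h0, hfd⟩ := exists_isHomogeneous_initialDegree
    (hX.extremalForm_pow_mem hb (m := t) (t := t) (Nat.le_mul_of_pos_right t (by omega)))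
    (pow_ne_zero t (extremalForm_ne_zero b)) ((isHomogeneous_extremalForm hb).pow t)
  refine le_degree_of_hasMultiplicitiesGE hb h0 hfd ?_
  rwa [← hX.mem_fatPointsIdeal_iff, ← hX.symbolicPower_eq]

theorem passesThroughHalf_rationalCurve (b : ℕ) :
    PassesThroughHalf (b + 1) (rationalCurve k (b + 1)) := by
  refine ⟨isHomogeneous_rationalCurve b, fun i hi => ?_, fun i hi => ?_,
    (hasMultiplicityAt_rationalCurve_vertex b).1⟩
  · simpa [fatPointIdeal] using (hasMultiplicityAt_rationalCurve_odd (k := k) b hi).1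
  · simpa [fatPointIdeal] using (hasMultiplicityAt_rationalCurve_one (k := k) b hi).1

/-- A second curve with the same points would meet the rational curve of degree `b + 1` at least
`2 (b + 1) + b ^ 2 = (b + 1) ^ 2 + 1` times. -/
theorem PassesThroughHalf.exists_eq_smul {b : ℕ} {g : MvPolynomial (Fin 3) k}
    (hg : PassesThroughHalf (b + 1) g) : ∃ c : k, g = c • rationalCurve k (b + 1) := by
  obtain ⟨hhom, hodd, hone, hvertex⟩ := hg
  by_cases hdvd : rationalCurve k (b + 1) ∣ g
  · obtain ⟨q, rfl⟩ := hdvd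
    by_cases hq : rationalCurve k (b + 1) * q = 0
    · exact ⟨0, by rw [hq, zero_smul]⟩
    · obtain ⟨j, hj, hqj⟩ := (isHomogeneous_rationalCurve b).of_mul_left hq hhom
      have hj0 : j = 0 := by omega
      subst hj0
      refine ⟨coeff 0 q, ?_⟩
      rw [← totalDegree_zero_iff_isHomogeneous, totalDegree_eq_zero_iff_eq_C] at hqj
      rw [smul_eq_C_mul, mul_comm, ← hqj]
  · have e := sum_add_sum_add_le_of_not_rationalCurve_dvd b hhom hdvd (fun _ => 1) (fun _ => 1) b
      (fun i hi => by simpa [fatPointIdeal] using hodd i hi)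
      (fun i hi => by simpa [fatPointIdeal] using hone i hi) hvertex
    simp only [Finset.sum_const, Finset.card_range, smul_eq_mul] at e
    nlinarith

end Configuration

theorem mainTheorem6 {k : Type*} [Field k] [IsAlgClosed k] [CharZero k] (b : ℕ)
    (X : Set (ProjPlane k)) (hX : IsStandardKConfiguration ![1, b, 2 * b] X) :
    IsWaldschmidtConstant (pointsIdeal X) ((6 * (b : ℝ) - 5) / (2 * (b : ℝ) - 1)) ∧
    (∀ m : ℕ, 0 < m →
      initialDegree (symbolicPower (pointsIdeal X) (m * (2 * b - 1))) = m * (6 * b - 5)) ∧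
    ∃ f : MvPolynomial (Fin 3) k,
      Irreducible f ∧ PassesThroughHalf b f ∧
      (∀ g : MvPolynomial (Fin 3) k, PassesThroughHalf b g → ∃ c : k, g = c • f) ∧
      (extremalForm b f).IsHomogeneous (6 * b - 5) ∧
      (∀ P ∈ X, HasMultiplicityAt (extremalForm b f) P (2 * b - 1)) ∧
      (∀ m d : ℕ, 0 < m → d ≤ m * (6 * b - 5) → ∀ h ∈ fatPointsIdeal X (m * (2 * b - 1)),
        h.IsHomogeneous d → f ∣ h) := by
  -- The type is increasing, so `b ≥ 2`; write `b + 1` for `b`.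
  have hb2 : 1 < b := by simpa using hX.strictMono (show (0 : Fin 3) < 1 by decide)
  obtain ⟨b, rfl⟩ : ∃ n, b = n + 1 := ⟨b - 1, by omega⟩
  have hb : 1 ≤ b := by omega
  have hN : 2 * (b + 1) - 1 = 2 * b + 1 := by omega
  have hK : 6 * (b + 1) - 5 = 6 * b + 1 := by omega
  rw [hN, hK]
  refine ⟨?_, fun m hm => ?_, rationalCurve k (b + 1), irreducible_rationalCurve b,
    passesThroughHalf_rationalCurve b, fun g hg => hg.exists_eq_smul,
    isHomogeneous_extremalForm hb, hX.hasMultiplicityAt_extremalForm hb,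
    fun m d hm hd h hmem hh => ?_⟩
  · have h := tendsto_div_of_bounds (by omega) (hX.le_initialDegree hb) fun t =>
      hX.initialDegree_le hb (t := t) (m := t / (2 * b + 1) + 1)
        (by rw [mul_comm]; exact (Nat.lt_mul_div_succ t (by omega)).le)
    rw [IsWaldschmidtConstant]
    convert h using 2
    push_cast
    ring
  · refine le_antisymm (hX.initialDegree_le hb le_rfl) ?_
    have h := hX.le_initialDegree hb (m * (2 * b + 1))
    refine Nat.le_of_mul_le_mul_left ?_ (show 0 < 2 * b + 1 by omega)
    calc (2 * b + 1) * (m * (6 * b + 1)) = (6 * b + 1) * (m * (2 * b + 1)) := by ring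
      _ ≤ _ := h
  · exact rationalCurve_dvd_of_hasMultiplicitiesGE b hm hd hh
      ((hX.mem_fatPointsIdeal_iff _ _).mp hmem)
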